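/- Let $\Sigma=\{0,1\}$, and let a pairing function be a polynomial-time computable bijection $\langle\cdot,\cdot\rangle:\Sigma^*\times\Sigma^*\to\Sigma^*$ with polynomial-time computable inverses; FP is the class of total polynomial-time computable functions. For a total function $\sigma:\Sigma^*\times\Sigma^*\to\Sigma^*$ define: - $\sigma$ is *honest* if there is a polynomial $q$ such that every $z\in\mathrm{image}(\sigma)$ has $a,b$ with $\sigma(a,b)=z$ and $|a|+|b|\le q(|z|)$. - $\sigma$ is *s-honest* if there is a polynomial $q$ such that whenever $\sigma(a,b)=z$, there is $b'$ with $\sigma(a,b')=z$ and $|b'|\le q(|z|+|a|)$, and there is $a'$ with $\sigma(a',b)=z$ and $|a'|\le q(|z|+|b|)$. - $\sigma$ is *one-way* if it is honest, polynomial-time computable, and no $g\in\mathrm{FP}$, $g:\Sigma^*\to\Sigma^*\times\Sigma^*$, satisfies $\sigma(g(z))=z$ for all $z\in\mathrm{image}(\sigma)$. - $\sigma$ is *strongly one-way* (with respect to a pairing function) if it is s-honest, polynomial-time computable, no $g_1\in\mathrm{FP}$ satisfies $\sigma(a,g_1(\langle a,z\rangle))=z$ for all $a,b,z$ with $\sigma(a,b)=z$,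 and no $g_2\in\mathrm{FP}$ satisfies $\sigma(g_2(\langle b,z\rangle),b)=z$ for all $a,b,z$ with $\sigma(a,b)=z$. - $\sigma$ is *overstrong* if no $f\in\mathrm{FP}$, $f:\{1,2\}\times\Sigma^*\times\Sigma^*\to\Sigma^*\times\Sigma^*$, has the property that for each $i\in\{1,2\}$ and all $z,a\in\Sigma^*$: if there is $b$ with ($i=1$ and $\sigma(a,b)=z$) or ($i=2$ and $\sigma(b,a)=z$), then $\sigma(f(i,z,a))=z$. **Proposition.** If $\mathrm P\ne\mathrm{NP}$, then there is a total, polynomial-time computable, honest, s-honest, overstrong function $\sigma:\Sigma^*\times\Sigma^*\to\Sigma^*$ that moreover is one-way and, with respect to every pairing function, strongly one-way. In particular, if $\mathrm P\ne\mathrm{NP}$, there is a total 2-ary function that is both one-way and strongly one-way. -/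

import Mathlib

namespace OneWay

/-- Strings over the binary alphabet. -/
abbrev Str : Type := List Bool

/-- A pair of strings as a machine input or output: `a#b`, over the alphabet `{0, 1, #}`
(`none` is the separator `#`). -/
def encPair (p : Str × Str) : List (Option Bool) :=
  p.1.map some ++ none :: p.2.map some

/-- A triple `(i, z, a)` with an index `i` out of two as a machine input: one bit for the index,
followed by `z#a`. The elements `0, 1` of `Fin 2` stand for the argument positions 1 and 2. -/
def encIdxPair (t : Fin 2 × Str × Str) : List (Option Bool) :=
  some (decide (t.1 = 1)) :: encPair t.2

/-- The total function `f`, with its arguments and values written down by `ea` and `eb`, is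
computed by a Turing machine in time polynomial in the length of the input. -/
def PolyTime {α β Γ₀ Γ₁ : Type} (ea : α → List Γ₀) (eb : β → List Γ₁) (f : α → β) : Prop :=
  Nonempty (Turing.TM2ComputableInPolyTime ea eb f)

/-- `f : Σ* → Σ*` is in FP. -/
def FP (f : Str → Str) : Prop := PolyTime id id f

/-- `f : Σ* → Σ* × Σ*` is in FP. -/
def FPToPair (f : Str → Str × Str) : Prop := PolyTime id encPair f

/-- `f : {1, 2} × Σ* × Σ* → Σ* × Σ*` is in FP. -/
def FPIdxToPair (f : Fin 2 × Str × Str → Str × Str) : Prop := PolyTime encIdxPair encPair f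

/-- The total 2-ary function `σ` is polynomial-time computable. -/
def PolyTimeComputable (σ : Str → Str → Str) : Prop :=
  PolyTime encPair id (fun p : Str × Str => σ p.1 p.2)

/-- The class P: the languages that are decided in polynomial time. -/
def ClassP : Set (Set Str) :=
  {L | ∃ χ : Str → Bool, PolyTime id (fun b : Bool => [b]) χ ∧ ∀ x, x ∈ L ↔ χ x = true}

/-- The class NP: the languages `{x | ∃ y, R x y}` for a relation `R` that is decided in
polynomial time and polynomially balanced (`R x y` implies that `y` has length polynomial in the
length of `x`). -/
def ClassNP : Set (Set Str) :=
  {L | ∃ R : Str → Str → Bool,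
    PolyTime encPair (fun b : Bool => [b]) (fun p : Str × Str => R p.1 p.2) ∧
    (∃ q : Polynomial ℕ, ∀ x y, R x y = true → y.length ≤ q.eval x.length) ∧
    ∀ x, x ∈ L ↔ ∃ y, R x y = true}

/-- `pair` is a pairing function: a polynomial-time computable bijection from `Σ* × Σ*` onto `Σ*`
with polynomial-time computable inverses. (Monotonicity in each argument is not demanded, so
that monotone pairing functions are a special case.) -/
structure IsPairing (pair : Str → Str → Str) : Prop where
  polyTimeComputable : PolyTimeComputable pair
  bijective : Function.Bijective (fun p : Str × Str => pair p.1 p.2)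
  inverses : ∃ π₁ π₂ : Str → Str, FP π₁ ∧ FP π₂ ∧
    ∀ a b, π₁ (pair a b) = a ∧ π₂ (pair a b) = b

/-! The following notions are stated for total 2-ary functions `σ`: `z` is in the image of `σ` if
and only if `∃ a b, σ a b = z`, and every pair is in the domain. -/

/-- `σ` is honest. -/
def Honest (σ : Str → Str → Str) : Prop :=
  ∃ q : Polynomial ℕ, ∀ z, (∃ a b, σ a b = z) →
    ∃ a b, a.length + b.length ≤ q.eval z.length ∧ σ a b = z

/-- `σ` is (polynomial-time) noninvertible. -/
def Noninvertible (σ : Str → Str → Str) : Prop :=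
  ¬ ∃ g : Str → Str × Str, FPToPair g ∧
    ∀ z, (∃ a b, σ a b = z) → σ (g z).1 (g z).2 = z

/-- `σ` is one-way. -/
def IsOneWay (σ : Str → Str → Str) : Prop :=
  Honest σ ∧ PolyTimeComputable σ ∧ Noninvertible σ

/-- `σ` is s-honest. -/
def SHonest (σ : Str → Str → Str) : Prop :=
  ∃ q : Polynomial ℕ,
    (∀ z a, (∃ b, σ a b = z) →
      ∃ b', b'.length ≤ q.eval (z.length + a.length) ∧ σ a b' = z) ∧
    (∀ z b, (∃ a, σ a b = z) →
      ∃ a', a'.length ≤ q.eval (z.length + b.length) ∧ σ a' b = z)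

/-- `σ` is (polynomial-time) invertible with respect to the first argument. -/
def InvertibleFirst (pair : Str → Str → Str) (σ : Str → Str → Str) : Prop :=
  ∃ g₁ : Str → Str, FP g₁ ∧ ∀ z a b, σ a b = z → σ a (g₁ (pair a z)) = z

/-- `σ` is (polynomial-time) invertible with respect to the second argument. -/
def InvertibleSecond (pair : Str → Str → Str) (σ : Str → Str → Str) : Prop :=
  ∃ g₂ : Str → Str, FP g₂ ∧ ∀ z a b, σ a b = z → σ (g₂ (pair b z)) b = z

/-- `σ` is strongly noninvertible. -/
def StronglyNoninvertible (pair : Str → Str → Str) (σ : Str → Str → Str) : Prop :=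
  ¬ InvertibleFirst pair σ ∧ ¬ InvertibleSecond pair σ

/-- `σ` is strongly one-way. -/
def IsStronglyOneWay (pair : Str → Str → Str) (σ : Str → Str → Str) : Prop :=
  SHonest σ ∧ PolyTimeComputable σ ∧ StronglyNoninvertible pair σ

/-- `σ` is overstrong. -/
def Overstrong (σ : Str → Str → Str) : Prop :=
  ¬ ∃ f : Fin 2 × Str × Str → Str × Str, FPIdxToPair f ∧
    ∀ (i : Fin 2) (z a : Str),
      (∃ b, (σ a b = z ∧ i = 0) ∨ (σ b a = z ∧ i = 1)) →
        σ (f (i, z, a)).1 (f (i, z, a)).2 = z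

end OneWay

/-! Choose a language in NP but not in P, with verifier `R`. Let σ(0x, 1w) = σ(1w, 0x) = 0x if `R x
w` holds, and let σ be the empty word otherwise (`witnessed`). A nonempty value must be of the form
0x, and each of its preimages consists of 0x itself and a word 1w with `R x w`. Hence any preimage
of 0x proves membership of x (`witnessed_eq_cons`), while if x is a member then 0x is in the image.

All the notions of hardness follow from one reduction, `mem_classP_of_invert`. Suppose that H is in
FP and maps 0x to a preimage of 0x whenever there is one. Then x is a member if and only if σ(H(0x))
= 0x, and this can be tested in polynomial time, whatever H does on other words. Knowing an argument
does not help the inverter, because that argument may be 0x, which the value already gives. So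
inverters with either argument given, and the inverters excluded by overstrongness, all yield such
an H. Symmetry of σ handles the two positions alike. Both kinds of honesty hold because witnesses
have polynomial length and the empty word has short preimages.

The remaining work is to show that the functions involved are computed by Turing machines in
polynomial time. For this there is a small language of stack programs with registers, in which given
machines serve as subroutines. Its link to machines is `polyTime_of_does`. From it come closure
under composition (`polyTime_comp`), pairing, the equality test and the computability of σ. -/

namespace StackProgram

open Turing Function

/-! ### Step-counted execution of stack programs -/

section Steps

variable {K : Type} [DecidableEq K] {Γ : K → Type} {Λ Λ' S : Type}

/-- `Steps m n c c'`: the program `m` goes from `c` to `c'` in exactly `n` steps. -/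
inductive Steps (m : Λ → TM2.Stmt Γ Λ S) : ℕ → TM2.Cfg Γ Λ S → TM2.Cfg Γ Λ S → Prop
  | refl (c) : Steps m 0 c c
  | head {l v r n c'} (h : Steps m n (TM2.stepAux (m l) v r) c') : Steps m (n + 1) ⟨some l, v, r⟩ c'

theorem Steps.trans {m : Λ → TM2.Stmt Γ Λ S} {n n' : ℕ} {c c' c'' : TM2.Cfg Γ Λ S}
    (h : Steps m n c c') (h' : Steps m n' c' c'') : Steps m (n + n') c c'' := by
  induction h with
  | refl c => simpa using h'
  | head h ih => rw [Nat.succ_add]; exact Steps.head (ih h')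

theorem iterate_bind_none {α : Type} (f : α → Option α) (n : ℕ) :
    (flip bind f)^[n] none = none := by
  induction n with
  | zero => rfl
  | succ n ih => rw [iterate_succ_apply]; exact ih

/-- The right-hand side is the iteration by which `TM2OutputsInTime` counts steps; the inductive
form on the left is the one suited to composing runs. -/
theorem steps_iff_iterate {m : Λ → TM2.Stmt Γ Λ S} {n : ℕ} {c c' : TM2.Cfg Γ Λ S} :
    Steps m n c c' ↔ (flip bind (TM2.step m))^[n] (some c) = some c' := by
  constructor
  · intro h
    induction h with
    | refl c => rfl
    | head h ih => rw [iterate_succ_apply]; exact ih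
  · induction n generalizing c with
    | zero => intro h; cases Option.some.inj h; exact .refl _
    | succ n ih =>
      intro h
      rw [iterate_succ_apply] at h
      obtain ⟨_ | l, v, r⟩ := c
      · change (flip bind (TM2.step m))^[n] none = _ at h
        rw [iterate_bind_none] at h
        cases h
      · exact .head (ih h)

/-- Rename the labels of a statement by `f` and let it continue at `e` in place of halting. -/
def relabel (f : Λ → Λ') (e : Option Λ') : TM2.Stmt Γ Λ S → TM2.Stmt Γ Λ' S
  | .push k g q => .push k g (relabel f e q)
  | .peek k g q => .peek k g (relabel f e q)
  | .pop k g q => .pop k g (relabel f e q)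
  | .load g q => .load g (relabel f e q)
  | .branch p q₁ q₂ => .branch p (relabel f e q₁) (relabel f e q₂)
  | .goto l => .goto fun s => f (l s)
  | .halt => e.elim .halt fun l => .goto fun _ => l

/-- The configuration corresponding to `c` after `relabel f e`. -/
def relabelCfg (f : Λ → Λ') (e : Option Λ') (c : TM2.Cfg Γ Λ S) : TM2.Cfg Γ Λ' S :=
  ⟨c.l.elim e fun l => some (f l), c.var, c.stk⟩

theorem stepAux_relabel (f : Λ → Λ') (e : Option Λ') (q : TM2.Stmt Γ Λ S) (v : S)
    (r : ∀ k, List (Γ k)) :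
    TM2.stepAux (relabel f e q) v r = relabelCfg f e (TM2.stepAux q v r) := by
  induction q generalizing v r with
  | push k g q ih => exact ih _ _
  | peek k g q ih => exact ih _ _
  | pop k g q ih => exact ih _ _
  | load g q ih => exact ih _ _
  | branch p q₁ q₂ ih₁ ih₂ =>
    simp only [relabel, TM2.stepAux]
    cases p v
    · exact ih₂ _ _
    · exact ih₁ _ _
  | goto l => rfl
  | halt => cases e <;> rfl

/-- A halt turned into a jump happens within the same step, so the step count is unchanged and the
times of successive programs simply add up. -/
theorem Steps.relabel {m : Λ → TM2.Stmt Γ Λ S} {m' : Λ' → TM2.Stmt Γ Λ' S} {f : Λ → Λ'}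
    {e : Option Λ'} (hm : ∀ l, m' (f l) = relabel f e (m l)) {n : ℕ} {c c' : TM2.Cfg Γ Λ S}
    (h : Steps m n c c') : Steps m' n (relabelCfg f e c) (relabelCfg f e c') := by
  induction h with
  | refl c => exact .refl _
  | head h ih =>
    refine .head ?_
    rw [hm, stepAux_relabel]
    exact ih

end Steps

/-- A program over the stacks `Γ` with internal state `S`. -/
structure Prog {K : Type} (Γ : K → Type) (S : Type) where
  Λ : Type
  [fin : Fintype Λ]
  main : Λ
  m : Λ → TM2.Stmt Γ Λ S

attribute [instance] Prog.fin

/-! ### Sequencing, case distinction and loops -/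

namespace Prog

variable {K : Type} [DecidableEq K] {Γ : K → Type} {P A : Type}

/-- A run from start to end in exactly `n` steps. -/
def Eval {S : Type} (F : Prog Γ S) (n : ℕ) (v v' : S) (r r' : ∀ k, List (Γ k)) : Prop :=
  Steps F.m n ⟨some F.main, v, r⟩ ⟨none, v', r'⟩

/-- `F` transforms the stacks `r` into `r'` within `t` steps. Its state is a pair of which the
first component is `p` at the start and at the end; the second component is arbitrary. -/
def Runs (F : Prog Γ (P × Option A)) (p : P) (r r' : ∀ k, List (Γ k)) (t : ℕ) : Prop :=
  ∀ v, ∃ v' n, n ≤ t ∧ F.Eval n (p, v) (p, v') r r'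

theorem Runs.mono {F : Prog Γ (P × Option A)} {p : P} {r r' : ∀ k, List (Γ k)} {t t' : ℕ}
    (h : F.Runs p r r' t) (ht : t ≤ t') : F.Runs p r r' t' := fun v =>
  let ⟨v', n, hn, h⟩ := h v
  ⟨v', n, hn.trans ht, h⟩

/-- Load a new state. -/
def load {S : Type} (g : S → S) : Prog Γ S := ⟨Unit, (), fun _ => .load g .halt⟩

theorem eval_load {S : Type} (g : S → S) (v : S) (r : ∀ k, List (Γ k)) :
    (load g).Eval 1 v (g v) r r := Steps.head (.refl _)

def skip : Prog Γ (P × Option A) := ⟨Unit, (), fun _ => .halt⟩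

theorem runs_skip (p : P) (r : ∀ k, List (Γ k)) :
    (skip : Prog Γ (P × Option A)).Runs p r r 1 :=
  fun v => ⟨v, 1, le_rfl, Steps.head (.refl _)⟩

def push (k : K) (a : Γ k) : Prog Γ (P × Option A) := ⟨Unit, (), fun _ => .push k (fun _ => a) .halt⟩

theorem runs_push (p : P) (r : ∀ k, List (Γ k)) (k : K) (a : Γ k) :
    (push k a : Prog Γ (P × Option A)).Runs p r (update r k (a :: r k)) 1 :=
  fun v => ⟨v, 1, le_rfl, Steps.head (.refl _)⟩

/-- Run `F`, then `G`. -/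
def seq {S : Type} (F G : Prog Γ S) : Prog Γ S where
  Λ := F.Λ ⊕ G.Λ
  main := .inl F.main
  m := Sum.elim (fun l => relabel .inl (some (.inr G.main)) (F.m l))
    (fun l => relabel .inr none (G.m l))

theorem Eval.seq {S : Type} {F G : Prog Γ S} {n n' : ℕ} {v v' v'' : S} {r r' r'' : ∀ k, List (Γ k)}
    (h : F.Eval n v v' r r') (h' : G.Eval n' v' v'' r' r'') :
    (F.seq G).Eval (n + n') v v'' r r'' :=
  (Steps.relabel (m' := (F.seq G).m) (f := .inl) (e := some (.inr G.main)) (fun _ => rfl) h).trans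
    (Steps.relabel (m' := (F.seq G).m) (f := .inr) (e := none) (fun _ => rfl) h')

theorem Runs.seq {F G : Prog Γ (P × Option A)} {p : P} {r r' r'' : ∀ k, List (Γ k)} {t t' : ℕ}
    (h : F.Runs p r r' t) (h' : G.Runs p r' r'' t') : (F.seq G).Runs p r r'' (t + t') := fun v =>
  let ⟨_, _, hn, h₁⟩ := h v
  let ⟨v'', _, hn', h₂⟩ := h' _
  ⟨v'', _, add_le_add hn hn', h₁.seq h₂⟩

/-- Pop the stack `k` and continue with a program that depends on what was there. -/
def popCase [Fintype A] (k : K) (φ : Γ k → A) (c : Option A → Prog Γ (P × Option A)) :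
    Prog Γ (P × Option A) where
  Λ := Option (Σ a, (c a).Λ)
  main := none
  m := fun
    | none => .pop k (fun s o => (s.1, o.map φ)) (.goto fun s => some ⟨s.2, (c s.2).main⟩)
    | some ⟨a, l⟩ => relabel (fun l => some ⟨a, l⟩) none ((c a).m l)

theorem Runs.popCase [Fintype A] {k : K} {φ : Γ k → A} {c : Option A → Prog Γ (P × Option A)} {p : P}
    {r r' : ∀ k, List (Γ k)} {t : ℕ}
    (h : (c ((r k).head?.map φ)).Runs p (update r k (r k).tail) r' t) :
    (popCase k φ c).Runs p r r' (1 + t) := fun v =>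
  let ⟨v', n, hn, h⟩ := h ((r k).head?.map φ)
  ⟨v', 1 + n, by lia, Steps.trans (Steps.head (l := (Prog.popCase k φ c).main) (.refl _))
    (Steps.relabel (m' := (Prog.popCase k φ c).m) (e := none)
      (f := fun l => some ⟨(r k).head?.map φ, l⟩) (fun _ => rfl) h)⟩

/-- Pop the stack `k` and run `c` with what was there, until a symbol with `b` was popped or the
stack is empty. -/
def loop [Fintype A] (k : K) (φ : Γ k → A) (b : A → Bool) (c : A → Prog Γ (P × Option A)) :
    Prog Γ (P × Option A) where
  Λ := Option (Σ a, (c a).Λ)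
  main := none
  m := fun
    | none => .pop k (fun s o => (s.1, o.map φ)) (.branch (fun s => s.2.elim true b) .halt
        (.goto fun s => s.2.map fun a => ⟨a, (c a).main⟩))
    | some ⟨a, l⟩ => relabel (fun l => some ⟨a, l⟩) (some none) ((c a).m l)

theorem runs_loop_nil [Fintype A] {k : K} {φ : Γ k → A} {b : A → Bool}
    {c : A → Prog Γ (P × Option A)} {p : P} {r : ∀ k, List (Γ k)} (hr : r k = []) :
    (loop k φ b c).Runs p r r 1 := by
  intro v
  refine ⟨none, 1, le_rfl, Steps.head ?_⟩
  have h : update r k ([] : List (Γ k)) = r := by rw [← hr, update_eq_self]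
  simp only [loop, TM2.stepAux, hr, List.tail_nil, h]
  exact .refl _

theorem runs_loop_break [Fintype A] {k : K} {φ : Γ k → A} {b : A → Bool}
    {c : A → Prog Γ (P × Option A)} {p : P} {r : ∀ k, List (Γ k)} {a : Γ k} {l : List (Γ k)}
    (hr : r k = a :: l) (hb : b (φ a) = true) :
    (loop k φ b c).Runs p r (update r k l) 1 := by
  intro v
  refine ⟨some (φ a), 1, le_rfl, Steps.head ?_⟩
  simp only [loop, TM2.stepAux, hr, List.head?_cons, Option.map_some, Option.elim_some, hb,
    List.tail_cons]
  exact .refl _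

theorem Runs.loop_cons [Fintype A] {k : K} {φ : Γ k → A} {b : A → Bool}
    {c : A → Prog Γ (P × Option A)} {p : P} {r r' r'' : ∀ k, List (Γ k)} {a : Γ k} {l : List (Γ k)}
    {t t' : ℕ} (hr : r k = a :: l) (hb : b (φ a) = false)
    (h : (c (φ a)).Runs p (update r k l) r' t) (h' : (loop k φ b c).Runs p r' r'' t') :
    (loop k φ b c).Runs p r r'' (1 + t + t') := by
  intro v
  obtain ⟨v', n, hn, h⟩ := h (some (φ a))
  obtain ⟨v'', n', hn', h'⟩ := h' v'
  refine ⟨v'', 1 + n + n', by lia, Steps.trans (Steps.trans (Steps.head ?_)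
    (Steps.relabel (m' := (loop k φ b c).m) (e := some none) (f := fun l => some ⟨φ a, l⟩)
      (fun _ => rfl) h)) h'⟩
  simp only [loop, TM2.stepAux, hr, List.head?_cons, Option.map_some, Option.elim_some, hb,
    List.tail_cons]
  exact .refl _

/-- By `hk` the effect of the body commutes with overwriting the stack `k`. The body therefore does
not interfere with the word being consumed, and its effects can be collected in a fold. -/
theorem Runs.loop_append [Fintype A] {k : K} {φ : Γ k → A} {b : A → Bool}
    {c : A → Prog Γ (P × Option A)} {p : P} {t t' : ℕ}
    (g : A → (∀ k, List (Γ k)) → ∀ k, List (Γ k)) (hg : ∀ a r, (c a).Runs p r (g a r) t)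
    (hk : ∀ a r l, g a (update r k l) = update (g a r) k l) (l l' : List (Γ k))
    (hb : ∀ a ∈ l, b (φ a) = false) {r r'' : ∀ k, List (Γ k)} (hr : r k = l ++ l')
    (h : (loop k φ b c).Runs p (update (l.foldl (fun r a => g (φ a) r) r) k l') r'' t') :
    (loop k φ b c).Runs p r r'' ((1 + t) * l.length + t') := by
  induction l generalizing r with
  | nil =>
    rw [List.foldl_nil, ← List.nil_append l', ← hr, update_eq_self] at h
    simpa using h
  | cons a l ih =>
    -- The commutation `hk`, extended from one pass through the body to the whole fold.
    have key : ∀ (l : List (Γ k)) r l',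
        l.foldl (fun r a => g (φ a) r) (update r k l') =
          update (l.foldl (fun r a => g (φ a) r) r) k l' := by
      intro l
      induction l with
      | nil => intros; rfl
      | cons a l ih => intro r l'; rw [List.foldl_cons, hk, ih, List.foldl_cons]
    refine (Runs.loop_cons hr (hb a (by simp)) (hg _ _) (ih (r := g (φ a) (update r k (l ++ l')))
      (fun a ha => hb a (by simp [ha])) ?_ ?_)).mono ?_
    · rw [hk, update_self]
    · rw [hk, key, update_idem]; exact h
    · rw [List.length_cons]; lia

theorem foldl_update_cons {α : Type} {k' : K} (f : α → Γ k') (l : List α) (r : ∀ k, List (Γ k)) :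
    l.foldl (fun r a => update r k' (f a :: r k')) r =
      update r k' ((l.map f).reverse ++ r k') := by
  induction l generalizing r with
  | nil => simp
  | cons a l ih => rw [List.foldl_cons, ih]; simp

/-- Move the stack `k` onto the stack `k'`, up to the first symbol with `b`, which is removed. -/
def move [Fintype A] (k k' : K) (φ : Γ k → A) (b : A → Bool) (ψ : A → Γ k') :
    Prog Γ (P × Option A) :=
  loop k φ b fun a => push k' (ψ a)

section move

variable [Fintype A] {k k' : K} (φ : Γ k → A) (b : A → Bool) (ψ : A → Γ k') (p : P)
  (r : ∀ k, List (Γ k))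

theorem Runs.move_append (hk : k ≠ k') (l l' : List (Γ k)) (hb : ∀ a ∈ l, b (φ a) = false) (hr : r k = l ++ l')
    {r'' : ∀ k, List (Γ k)} {t' : ℕ}
    (h : (move k k' φ b ψ).Runs p
      (update (update r k' ((l.map fun a => ψ (φ a)).reverse ++ r k')) k l') r'' t') :
    (move k k' φ b ψ).Runs p r r'' (2 * l.length + t') := by
  refine Runs.loop_append (t := 1) (fun a r => update r k' (ψ a :: r k'))
    (fun _ _ => runs_push _ _ _ _) (fun a r l => ?_) l l' hb hr ?_
  · rw [update_of_ne hk.symm, update_comm hk]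
  · rw [foldl_update_cons fun a => ψ (φ a)]; exact h

theorem runs_move (hk : k ≠ k') (hb : ∀ a ∈ r k, b (φ a) = false) :
    (move k k' φ b ψ).Runs p r
      (update (update r k' (((r k).map fun a => ψ (φ a)).reverse ++ r k')) k [])
      (2 * (r k).length + 1) :=
  Runs.move_append φ b ψ p r hk (r k) [] hb (by simp) (runs_loop_nil (by simp))

theorem runs_move_break (hk : k ≠ k') (l l' : List (Γ k)) (a : Γ k) (hb : ∀ a ∈ l, b (φ a) = false)
    (ha : b (φ a) = true) (hr : r k = l ++ a :: l') :
    (move k k' φ b ψ).Runs p r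
      (update (update r k' ((l.map fun a => ψ (φ a)).reverse ++ r k')) k l')
      (2 * l.length + 1) :=
  Runs.move_append φ b ψ p r hk l (a :: l') hb hr <| by
    simpa [move] using runs_loop_break (k := k) (φ := φ) (b := b) (c := fun a => push k' (ψ a)) (p := p)
      (r := update (update r k' ((l.map fun a => ψ (φ a)).reverse ++ r k')) k (a :: l'))
      (by simp) ha

end move

end Prog

/-! ### Machines as subroutines -/

section Submachine

variable {Q : Type} [DecidableEq Q] {K₀ : Type} [DecidableEq K₀]

/-- The stacks `K₀` together with the stacks of the machines `M`. -/
abbrev WithSub (K₀ : Type) (M : Q → FinTM2) : Type := K₀ ⊕ Σ q, (M q).K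

/-- The stack alphabets for `WithSub`. -/
abbrev withSub (Γ₀ : K₀ → Type) (M : Q → FinTM2) : WithSub K₀ M → Type
  | .inl k => Γ₀ k
  | .inr ⟨q, k⟩ => (M q).Γ k

/-- The internal states of the machines `M`. -/
abbrev SubState (M : Q → FinTM2) : Type := ∀ q, (M q).σ

/-- The initial states of the machines `M`. -/
abbrev subInit (M : Q → FinTM2) : SubState M := fun q => (M q).initialState

variable {Γ₀ : K₀ → Type} {M : Q → FinTM2} {A : Type}

/-- A statement of the machine `M q`, acting on its part of stacks and states. -/
def liftStmt (Γ₀ : K₀ → Type) (M : Q → FinTM2) (A : Type) (q : Q) :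
    TM2.Stmt (M q).Γ (M q).Λ (M q).σ →
      TM2.Stmt (withSub Γ₀ M) (M q).Λ (SubState M × Option A)
  | .push k g s => .push (.inr ⟨q, k⟩) (fun v => g (v.1 q)) (liftStmt Γ₀ M A q s)
  | .peek k g s => .peek (.inr ⟨q, k⟩) (fun v o => (update v.1 q (g (v.1 q) o), v.2))
      (liftStmt Γ₀ M A q s)
  | .pop k g s => .pop (.inr ⟨q, k⟩) (fun v o => (update v.1 q (g (v.1 q) o), v.2))
      (liftStmt Γ₀ M A q s)
  | .load g s => .load (fun v => (update v.1 q (g (v.1 q)), v.2)) (liftStmt Γ₀ M A q s)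
  | .branch g s₁ s₂ => .branch (fun v => g (v.1 q)) (liftStmt Γ₀ M A q s₁) (liftStmt Γ₀ M A q s₂)
  | .goto l => .goto fun v => l (v.1 q)
  | .halt => .halt

/-- The configuration `C` extends the configuration `c` of `M q`. -/
structure Extends (q : Q) (p : SubState M) (v : Option A) (r : ∀ k, List (withSub Γ₀ M k))
    (c : TM2.Cfg (M q).Γ (M q).Λ (M q).σ)
    (C : TM2.Cfg (withSub Γ₀ M) (M q).Λ (SubState M × Option A)) : Prop where
  l : C.l = c.l
  var : C.var = (update p q c.var, v)
  stk : ∀ k, C.stk (.inr ⟨q, k⟩) = c.stk k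
  other : ∀ k, (∀ k', k ≠ .inr ⟨q, k'⟩) → C.stk k = r k

theorem extends_update {q : Q} {r R : ∀ k, List (withSub Γ₀ M k)} {T : ∀ k, List ((M q).Γ k)}
    (hT : ∀ k, R (.inr ⟨q, k⟩) = T k) (hR : ∀ k, (∀ k', k ≠ .inr ⟨q, k'⟩) → R k = r k)
    (k : (M q).K) (l : List ((M q).Γ k)) :
    (∀ k', update R (.inr ⟨q, k⟩) l (.inr ⟨q, k'⟩) = update T k l k') ∧
      ∀ k₁, (∀ k', k₁ ≠ .inr ⟨q, k'⟩) → update R (.inr ⟨q, k⟩) l k₁ = r k₁ := by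
  refine ⟨fun k' => ?_, fun k₁ h => ?_⟩
  · by_cases h : k' = k
    · subst h; rw [update_self, update_self]
    · rw [update_of_ne h, update_of_ne (by simpa using h), hT]
  · rw [update_of_ne (h k), hR k₁ h]

theorem extends_stepAux {q : Q} {p : SubState M} {v : Option A} {r : ∀ k, List (withSub Γ₀ M k)}
    (s : TM2.Stmt (M q).Γ (M q).Λ (M q).σ) (w : (M q).σ) (T : ∀ k, List ((M q).Γ k))
    (R : ∀ k, List (withSub Γ₀ M k)) (hT : ∀ k, R (.inr ⟨q, k⟩) = T k)
    (hR : ∀ k, (∀ k', k ≠ .inr ⟨q, k'⟩) → R k = r k) :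
    Extends q p v r (TM2.stepAux s w T)
      (TM2.stepAux (liftStmt Γ₀ M A q s) (update p q w, v) R) := by
  induction s generalizing w T R with
  | push k g s ih =>
    simp only [liftStmt, TM2.stepAux, update_self]
    rw [hT]
    exact ih _ _ _ (extends_update hT hR _ _).1 (extends_update hT hR _ _).2
  | peek k g s ih =>
    simp only [liftStmt, TM2.stepAux, update_self, update_idem]
    rw [hT]
    exact ih _ _ _ hT hR
  | pop k g s ih =>
    simp only [liftStmt, TM2.stepAux, update_self, update_idem]
    rw [hT]
    exact ih _ _ _ (extends_update hT hR _ _).1 (extends_update hT hR _ _).2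
  | load g s ih =>
    simp only [liftStmt, TM2.stepAux, update_self, update_idem]
    exact ih _ _ _ hT hR
  | branch g s₁ s₂ ih₁ ih₂ =>
    simp only [liftStmt, TM2.stepAux, update_self]
    cases g w
    · exact ih₂ _ _ _ hT hR
    · exact ih₁ _ _ _ hT hR
  | goto l => exact ⟨by simp [liftStmt], rfl, hT, hR⟩
  | halt => exact ⟨rfl, rfl, hT, hR⟩

/-- A step-by-step simulation: the lifted statements touch only the stacks and the state component
of `M q`, so `Extends` is an invariant. -/
theorem Steps.lift {q : Q} {p : SubState M} {v : Option A} {r : ∀ k, List (withSub Γ₀ M k)} {n : ℕ}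
    {c c' : TM2.Cfg (M q).Γ (M q).Λ (M q).σ} (h : Steps (M q).m n c c')
    {C : TM2.Cfg (withSub Γ₀ M) (M q).Λ (SubState M × Option A)} (hC : Extends q p v r c C) :
    ∃ C', Steps (fun l => liftStmt Γ₀ M A q ((M q).m l)) n C C' ∧ Extends q p v r c' C' := by
  induction h generalizing C with
  | refl c => exact ⟨C, .refl _, hC⟩
  | @head l w T n c' h ih =>
    obtain ⟨L, W, R⟩ := C
    obtain ⟨hl, hv, hT, hR⟩ := hC
    dsimp only at hl hv hT hR
    subst hl hv
    obtain ⟨C', h', hC'⟩ := ih (extends_stepAux ((M q).m l) w T R hT hR)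
    exact ⟨C', .head h', hC'⟩

namespace Prog

/-- Run the machine `M q` on its own stacks. -/
def run (Γ₀ : K₀ → Type) (M : Q → FinTM2) (A : Type) (q : Q) :
    Prog (withSub Γ₀ M) (SubState M × Option A) :=
  haveI := (M q).ΛFin
  ⟨(M q).Λ, (M q).main, fun l => liftStmt Γ₀ M A q ((M q).m l)⟩

end Prog

theorem initList_self (tm : FinTM2) (u : List (tm.Γ tm.k₀)) : (initList tm u).stk tm.k₀ = u := by
  simp [initList]

theorem initList_of_ne {tm : FinTM2} (u : List (tm.Γ tm.k₀)) {k : tm.K} (h : k ≠ tm.k₀) :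
    (initList tm u).stk k = [] := by
  simp [initList, h]

theorem haltList_self (tm : FinTM2) (u : List (tm.Γ tm.k₁)) : (haltList tm u).stk tm.k₁ = u := by
  simp [haltList]

theorem haltList_of_ne {tm : FinTM2} (u : List (tm.Γ tm.k₁)) {k : tm.K} (h : k ≠ tm.k₁) :
    (haltList tm u).stk k = [] := by
  simp [haltList, h]

/-- A machine that outputs a word halts, by definition, in its initial state and with all stacks
except the output stack empty. The subroutine is therefore ready for another call as soon as its
output stack has been emptied. -/
theorem Prog.runs_run {q : Q} {u : List ((M q).Γ (M q).k₀)} {v : List ((M q).Γ (M q).k₁)} {t : ℕ}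
    (h : TM2OutputsInTime (M q) u (some v) t) (r : ∀ k, List (withSub Γ₀ M k))
    (hr : ∀ k, r (.inr ⟨q, k⟩) = []) :
    (Prog.run Γ₀ M A q).Runs (subInit M)
      (update r (.inr ⟨q, (M q).k₀⟩) u) (update r (.inr ⟨q, (M q).k₁⟩) v) t := by
  intro w
  have hS : Steps (M q).m h.steps (initList (M q) u) (haltList (M q) v) :=
    steps_iff_iterate.2 h.evals_in_steps
  obtain ⟨⟨L, W, R⟩, h₁, h₂⟩ := hS.lift (p := subInit M) (v := w) (r := r)
    (C := ⟨some (M q).main, (subInit M, w), update r (.inr ⟨q, (M q).k₀⟩) u⟩) (by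
      refine ⟨rfl, ?_, fun k => ?_, fun k hk => update_of_ne (hk _) _ _⟩
      · change _ = (update (subInit M) q (subInit M q), w)
        rw [update_eq_self]
      · by_cases hk : k = (M q).k₀
        · subst hk; rw [initList_self]; simp
        · rw [initList_of_ne u hk]
          dsimp only
          rw [update_of_ne (by simpa using hk), hr])
  refine ⟨w, h.steps, h.steps_le_m, ?_⟩
  obtain ⟨hl, hv, hT, hR⟩ := h₂
  dsimp only at hl hv hT hR
  subst hl hv
  have hRe : R = update r (.inr ⟨q, (M q).k₁⟩) v := by
    funext k
    by_cases hk : ∃ k', k = .inr ⟨q, k'⟩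
    · obtain ⟨k', rfl⟩ := hk
      rw [hT]
      by_cases hk : k' = (M q).k₁
      · subst hk; rw [haltList_self]; simp
      · rw [haltList_of_ne v hk, update_of_ne (by simpa using hk), hr]
    · have hk' : ∀ k', k ≠ .inr ⟨q, k'⟩ := fun k' h => hk ⟨k', h⟩
      rw [hR k hk', update_of_ne (hk' _)]
  subst hRe
  -- `haltList` carries the initial state of the machine, so the tuple of all states is again
  -- `subInit M`.
  change Steps _ _ _ ⟨none, (update (subInit M) q (subInit M q), w), _⟩ at h₁
  rw [update_eq_self] at h₁
  exact h₁

end Submachine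

/-! ### Length of stacks in terms of running time -/

section Growth

variable {K : Type} [DecidableEq K] {Γ : K → Type} {Λ S : Type}

/-- The number of pushes in a statement. -/
def pushes : TM2.Stmt Γ Λ S → ℕ
  | .push _ _ q => pushes q + 1
  | .peek _ _ q => pushes q
  | .pop _ _ q => pushes q
  | .load _ q => pushes q
  | .branch _ q₁ q₂ => pushes q₁ + pushes q₂
  | .goto _ => 0
  | .halt => 0

theorem length_stepAux_le (q : TM2.Stmt Γ Λ S) (v : S) (r : ∀ k, List (Γ k)) (k : K) :
    ((TM2.stepAux q v r).stk k).length ≤ (r k).length + pushes q := by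
  induction q generalizing v r with
  | push k' g q ih =>
    refine (ih _ _).trans ?_
    by_cases h : k = k'
    · subst h; simp [pushes]; lia
    · rw [update_of_ne h, pushes]; lia
  | peek k' g q ih => exact ih _ _
  | pop k' g q ih =>
    refine (ih _ _).trans ?_
    by_cases h : k = k'
    · subst h; simp [pushes]
    · rw [update_of_ne h, pushes]
  | load g q ih => exact ih _ _
  | branch p q₁ q₂ ih₁ ih₂ =>
    simp only [TM2.stepAux, pushes]
    cases p v
    · exact (ih₂ _ _).trans (by lia)
    · exact (ih₁ _ _).trans (by lia)
  | goto l => simp [pushes]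
  | halt => simp [pushes]

theorem Steps.length_le {m : Λ → TM2.Stmt Γ Λ S} {C : ℕ} (hC : ∀ l, pushes (m l) ≤ C) {n : ℕ}
    {c c' : TM2.Cfg Γ Λ S} (h : Steps m n c c') (k : K) :
    (c'.stk k).length ≤ (c.stk k).length + C * n := by
  induction h with
  | refl c => simp
  | @head l v r n c' h ih =>
    have h₁ := length_stepAux_le (m l) v r k
    have h₂ := hC l
    rw [mul_add]
    dsimp only
    lia

omit [DecidableEq K] in
theorem exists_pushes_le [Fintype Λ] (m : Λ → TM2.Stmt Γ Λ S) : ∃ C, ∀ l, pushes (m l) ≤ C :=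
  ⟨Finset.univ.sup fun l => pushes (m l), fun l =>
    Finset.le_sup (f := fun l => pushes (m l)) (Finset.mem_univ l)⟩

/-- There are finitely many labels, so the number of pushes per step is bounded by a constant. This
later bounds the time for copying an output. -/
theorem Prog.exists_length_le {P A : Type} (F : Prog Γ (P × Option A)) :
    ∃ C, ∀ p r r' t, Nonempty A → F.Runs p r r' t → ∀ k, (r' k).length ≤ (r k).length + C * t := by
  obtain ⟨C, hC⟩ := exists_pushes_le F.m
  refine ⟨C, fun p r r' t _ h k => ?_⟩
  obtain ⟨v', n, hn, h⟩ := h none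
  exact (Steps.length_le hC h k).trans (by gcongr)

end Growth

/-! ### Polynomial bounds -/

section PolyBounded

/-- `t` is bounded by a polynomial in `ℓ`. -/
def PolyBounded {α : Type} (ℓ t : α → ℕ) : Prop := ∃ p : Polynomial ℕ, ∀ a, t a ≤ p.eval (ℓ a)

theorem eval_mono (p : Polynomial ℕ) {m n : ℕ} (h : m ≤ n) : p.eval m ≤ p.eval n := by
  rw [Polynomial.eval_eq_sum_range, Polynomial.eval_eq_sum_range]
  gcongr

namespace PolyBounded

variable {α : Type} {ℓ t t' : α → ℕ}

theorem mono (h : PolyBounded ℓ t') (ht : ∀ a, t a ≤ t' a) : PolyBounded ℓ t :=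
  let ⟨p, hp⟩ := h
  ⟨p, fun a => (ht a).trans (hp a)⟩

theorem const (c : ℕ) : PolyBounded ℓ fun _ => c := ⟨Polynomial.C c, fun a => by simp⟩

theorem self : PolyBounded ℓ ℓ := ⟨Polynomial.X, fun a => by simp⟩

theorem add (h : PolyBounded ℓ t) (h' : PolyBounded ℓ t') : PolyBounded ℓ fun a => t a + t' a :=
  let ⟨p, hp⟩ := h
  let ⟨p', hp'⟩ := h'
  ⟨p + p', fun a => by rw [Polynomial.eval_add]; exact add_le_add (hp a) (hp' a)⟩

theorem mul (h : PolyBounded ℓ t) (h' : PolyBounded ℓ t') : PolyBounded ℓ fun a => t a * t' a :=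
  let ⟨p, hp⟩ := h
  let ⟨p', hp'⟩ := h'
  ⟨p * p', fun a => by rw [Polynomial.eval_mul]; exact mul_le_mul' (hp a) (hp' a)⟩

theorem eval (q : Polynomial ℕ) (h : PolyBounded ℓ t) : PolyBounded ℓ fun a => q.eval (t a) :=
  let ⟨p, hp⟩ := h
  ⟨q.comp p, fun a => by rw [Polynomial.eval_comp]; exact eval_mono q (hp a)⟩

end PolyBounded

end PolyBounded

/-- A coding of the alphabet `X` by the symbols of registers. -/
class Code (X : Type) extends Fintype X where
  enc : X → Option Bool
  dec : Option Bool → X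
  dec_enc : ∀ x, dec (enc x) = x

instance : Code Bool := { enc := some, dec := fun a => a.getD false, dec_enc := fun _ => rfl }

instance : Code (Option Bool) := { enc := id, dec := id, dec_enc := fun _ => rfl }

/-- A word as the contents of a register. -/
def code {X : Type} [Code X] (u : List X) : List (Option Bool) := u.map Code.enc

/-- A machine that is used as a subroutine, with the translation of register symbols. -/
structure Sub where
  tm : FinTM2
  inc : Option Bool → tm.Γ tm.k₀
  out : tm.Γ tm.k₁ → Option Bool

/-- The subroutine maps `u` to `v` in time `t`. -/
def Sub.Computes (s : Sub) (u v : List (Option Bool)) (t : ℕ) : Prop :=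
  ∃ v', v'.map s.out = v ∧ Nonempty (TM2OutputsInTime s.tm (u.map s.inc) (some v') t)

/-! ### Polynomial-time functions as subroutines -/

section FromPolyTime

variable {α β X Y : Type} {ea : α → List X} {eb : β → List Y} {f : α → β}

theorem exists_sub [Code X] [Code Y] (h : OneWay.PolyTime ea eb f) : ∃ s : Sub, ∃ p : Polynomial ℕ, ∀ a,
    s.Computes (code (ea a)) (code (eb (f a))) (p.eval (ea a).length) := by
  obtain ⟨h⟩ := h
  refine ⟨⟨h.tm, fun a => h.inputAlphabet.symm (Code.dec a), fun a => Code.enc (h.outputAlphabet a)⟩,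
    h.time, fun a => ⟨(eb (f a)).map h.outputAlphabet.invFun, ?_, ⟨?_⟩⟩⟩
  · rw [List.map_map]
    exact List.map_congr_left fun x _ => by simp
  · have : (code (ea a)).map (fun a => h.inputAlphabet.symm (Code.dec a)) =
        (ea a).map h.inputAlphabet.invFun := by
      rw [code, List.map_map]
      exact List.map_congr_left fun x _ => by simp [Code.dec_enc]
    dsimp only
    rw [this]
    exact h.outputsFun a

/-- Each step writes a bounded number of symbols, so an output cannot be longer than a linear
function of input length and running time. -/
theorem polyBounded_length (h : OneWay.PolyTime ea eb f) :
    PolyBounded (fun a => (ea a).length) fun a => (eb (f a)).length := by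
  obtain ⟨h⟩ := h
  have := h.tm.ΛFin
  obtain ⟨C, hC⟩ := exists_pushes_le h.tm.m
  refine PolyBounded.mono (t' := fun a => (ea a).length + C * h.time.eval (ea a).length)
    (.add .self (.mul (.const C) (.eval _ .self))) fun a => ?_
  have hS : Steps h.tm.m _ _ _ := steps_iff_iterate.2 (h.outputsFun a).evals_in_steps
  have h₁ := hS.length_le hC h.tm.k₁
  rw [haltList_self, List.length_map] at h₁
  refine h₁.trans (add_le_add ?_ (Nat.mul_le_mul_left C (h.outputsFun a).steps_le_m))
  -- The output stack starts empty unless it is also the input stack.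
  by_cases hk : h.tm.k₁ = h.tm.k₀
  · rw [hk, initList_self, List.length_map]
  · rw [initList_of_ne _ hk]; simp

end FromPolyTime

/-! ### Register programs and their compilation to machines -/

section Registers

variable {Q : Type} [DecidableEq Q] {N : ℕ} {X Y : Type}

/-- The alphabets of the input stack, the output stack, and the registers. -/
abbrev ioAlph (N : ℕ) (X Y : Type) : Bool ⊕ Fin N → Type
  | .inl false => X
  | .inl true => Y
  | .inr _ => Option Bool

/-- All stacks of a program with `N` registers and the subroutines `s`. -/
abbrev Stk (s : Q → Sub) (N : ℕ) : Type := WithSub (Bool ⊕ Fin N) fun q => (s q).tm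

abbrev stkAlph (s : Q → Sub) (N : ℕ) (X Y : Type) : Stk s N → Type :=
  withSub (ioAlph N X Y) fun q => (s q).tm

abbrev subStart (s : Q → Sub) : SubState fun q => (s q).tm := subInit fun q => (s q).tm

/-- Programs with `N` registers and the subroutines `s`. -/
abbrev RegProg (s : Q → Sub) (N : ℕ) (X Y : Type) : Type 1 :=
  Prog (stkAlph s N X Y) ((SubState fun q => (s q).tm) × Option (Option Bool))

/-- The stacks between two calls of subroutines. -/
def layout (s : Q → Sub) (x : List X) (y : List Y) (r : Fin N → List (Option Bool)) :
    ∀ k, List (stkAlph s N X Y k)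
  | .inl (.inl false) => x
  | .inl (.inl true) => y
  | .inl (.inr i) => r i
  | .inr _ => []

variable {s : Q → Sub}

theorem update_layout_inp (x x' : List X) (y : List Y) (r : Fin N → List (Option Bool)) :
    update (layout s x y r) (.inl (.inl false)) x' = layout s x' y r := by
  funext k
  rcases k with ((_ | _) | k) | k <;> rfl

theorem update_layout_out (x : List X) (y y' : List Y) (r : Fin N → List (Option Bool)) :
    update (layout s x y r) (.inl (.inl true)) y' = layout s x y' r := by
  funext k
  rcases k with ((_ | _) | k) | k <;> rfl

theorem update_layout_reg (x : List X) (y : List Y) (r : Fin N → List (Option Bool)) (i : Fin N)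
    (l : List (Option Bool)) :
    update (layout s x y r) (.inl (.inr i)) l = layout s x y (update r i l) := by
  funext k
  rcases k with ((_ | _) | k) | k
  · rfl
  · rfl
  · by_cases h : k = i
    · subst h; rw [update_self]; simp [layout]
    · rw [update_of_ne (by simpa using h)]; simp [layout, h]
  · rfl

namespace RegProg

/-- `F` transforms the registers `r` into `r'` within `t` steps. -/
def Does (F : RegProg s N X Y) (r r' : Fin N → List (Option Bool)) (t : ℕ) : Prop :=
  F.Runs (subStart s) (layout s [] [] r) (layout s [] [] r') t

variable {F G : RegProg s N X Y} {r r' r'' : Fin N → List (Option Bool)} {t t' : ℕ}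

theorem Does.of_eq (h : F.Does r r' t) (e : r' = r'') : F.Does r r'' t := e ▸ h

theorem Does.mono (h : F.Does r r' t) (ht : t ≤ t') : F.Does r r' t' := Prog.Runs.mono h ht

theorem Does.seq (h : F.Does r r' t) (h' : G.Does r' r'' t') :
    Does (F.seq G) r r'' (t + t') := Prog.Runs.seq h h'

theorem does_skip : Does (Prog.skip : RegProg s N X Y) r r 1 := Prog.runs_skip _ _

def push (i : Fin N) (a : Option Bool) : RegProg s N X Y :=
  Prog.push (Γ := stkAlph s N X Y) (.inl (.inr i)) a

theorem does_push (i : Fin N) (a : Option Bool) :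
    (push i a : RegProg s N X Y).Does r (update r i (a :: r i)) 1 := by
  unfold Does
  rw [← update_layout_reg]
  exact Prog.runs_push _ _ _ _

def popCase (i : Fin N) (c : Option (Option Bool) → RegProg s N X Y) : RegProg s N X Y :=
  Prog.popCase (Γ := stkAlph s N X Y) (.inl (.inr i)) id c

theorem Does.popCase {i : Fin N} {c : Option (Option Bool) → RegProg s N X Y}
    (h : (c (r i).head?).Does (update r i (r i).tail) r' t) : (popCase i c).Does r r' (1 + t) := by
  unfold Does at h
  rw [← update_layout_reg] at h
  refine Prog.Runs.popCase ?_
  rw [Option.map_id]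
  exact h

def loop (i : Fin N) (c : Option Bool → RegProg s N X Y) : RegProg s N X Y :=
  Prog.loop (Γ := stkAlph s N X Y) (.inl (.inr i)) id (fun _ => false) c

theorem does_loop_nil {i : Fin N} {c : Option Bool → RegProg s N X Y} (hr : r i = []) :
    (loop i c).Does r r 1 := Prog.runs_loop_nil hr

theorem Does.loop_cons {i : Fin N} {c : Option Bool → RegProg s N X Y} {a : Option Bool}
    {l : List (Option Bool)} (hr : r i = a :: l) (h : (c a).Does (update r i l) r' t)
    (h' : (loop i c).Does r' r'' t') : (loop i c).Does r r'' (1 + t + t') := by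
  unfold Does at h
  rw [← update_layout_reg] at h
  exact Prog.Runs.loop_cons hr rfl h h'

/-- Move the register `i` onto the register `j`. -/
def move (i j : Fin N) : RegProg s N X Y :=
  Prog.move (Γ := stkAlph s N X Y) (.inl (.inr i)) (.inl (.inr j)) id (fun _ => false) id

theorem does_move {i j : Fin N} (hij : i ≠ j) :
    (move i j : RegProg s N X Y).Does r (update (update r j ((r i).reverse ++ r j)) i [])
      (2 * (r i).length + 1) := by
  have h := Prog.runs_move (Γ := stkAlph s N X Y) (k := .inl (.inr i)) (k' := .inl (.inr j)) id
    (fun _ => false) id (subStart s) (layout s [] [] r) (by simpa using hij) (fun _ _ => rfl)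
  rw [update_layout_reg, update_layout_reg] at h
  simpa [layout, Does, move] using h

/-- Move the register `i` onto the register `j`, up to the first separator. -/
def moveSep (i j : Fin N) : RegProg s N X Y :=
  Prog.move (Γ := stkAlph s N X Y) (.inl (.inr i)) (.inl (.inr j)) id Option.isNone id

theorem does_moveSep {i j : Fin N} (hij : i ≠ j) (u : List Bool) (l : List (Option Bool))
    (hr : r i = u.map some ++ none :: l) :
    (moveSep i j : RegProg s N X Y).Does r (update (update r j ((u.map some).reverse ++ r j)) i l)
      (2 * u.length + 1) := by
  have h := Prog.runs_move_break (Γ := stkAlph s N X Y) (k := .inl (.inr i)) (k' := .inl (.inr j)) id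
    Option.isNone id (subStart s) (layout s [] [] r) (by simpa using hij) (u.map some) l none
    (fun a ha => by obtain ⟨b, _, rfl⟩ := List.mem_map.1 ha; rfl) rfl hr
  rw [update_layout_reg, update_layout_reg] at h
  simpa [layout, Does, moveSep, Function.comp_def] using h

/-- Move the register `i` onto both registers `j` and `k`. -/
def dup (i j k : Fin N) : RegProg s N X Y := loop i fun a => (push j a).seq (push k a)

theorem does_dup {i j k : Fin N} (hij : i ≠ j) (hik : i ≠ k) (hjk : j ≠ k) :
    (dup i j k : RegProg s N X Y).Does r
      (update (update (update r j ((r i).reverse ++ r j)) k ((r i).reverse ++ r k)) i [])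
      (3 * (r i).length + 1) := by
  generalize hl : r i = l
  induction l generalizing r with
  | nil =>
    refine (does_loop_nil hl).of_eq ?_
    simp only [List.reverse_nil, List.nil_append, update_eq_self]
    rw [← hl, update_eq_self]
  | cons a l ih =>
    refine ((Does.loop_cons hl ((does_push j a).seq (does_push k a)) (ih ?_)).of_eq ?_).mono
      (t := 1 + (1 + 1) + (3 * l.length + 1)) (by rw [List.length_cons]; lia)
    · simp [hij, hik]
    · funext m
      simp only [update_apply, hij.symm, hik.symm, hjk, hjk.symm, if_true, if_false]
      by_cases h₁ : m = i
      · simp [h₁]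
      · by_cases h₂ : m = j
        · simp [h₂, hjk, hij.symm]
        · by_cases h₃ : m = k
          · simp [h₃, hik.symm]
          · simp [h₁, h₂, h₃]

/-- Call the subroutine `q`. Words are stored in reversed order. -/
def call (q : Q) (i j : Fin N) : RegProg s N X Y :=
  (Prog.move (Γ := stkAlph s N X Y) (.inl (.inr i)) (.inr ⟨q, (s q).tm.k₀⟩) id (fun _ => false)
    (s q).inc).seq
  ((Prog.run (ioAlph N X Y) (fun q => (s q).tm) (Option Bool) q).seq
  (Prog.move (Γ := stkAlph s N X Y) (.inr ⟨q, (s q).tm.k₁⟩) (.inl (.inr j)) (s q).out (fun _ => false)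
    id))

theorem does_call {q : Q} {i j : Fin N} {u v : List (Option Bool)} (h : (s q).Computes u v t)
    (hr : r i = u.reverse) :
    (call q i j : RegProg s N X Y).Does r
      (update (update r i []) j (v.reverse ++ update r i [] j))
      (2 * u.length + 1 + (t + (2 * v.length + 1))) := by
  obtain ⟨v', rfl, ⟨h⟩⟩ := h
  have h₁ := Prog.runs_move (Γ := stkAlph s N X Y) (k := .inl (.inr i))
    (k' := .inr ⟨q, (s q).tm.k₀⟩) id (fun _ => false) (s q).inc (subStart s) (layout s [] [] r)
    (by simp) (fun _ _ => rfl)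
  rw [update_comm (by simp), update_layout_reg] at h₁
  have h₂ := Prog.runs_run (q := q) (Γ₀ := ioAlph N X Y) (M := fun q => (s q).tm) (A := Option Bool)
    h (layout s [] [] (update r i [])) (fun _ => rfl)
  have h₃ := Prog.runs_move (Γ := stkAlph s N X Y) (k := .inr ⟨q, (s q).tm.k₁⟩)
    (k' := .inl (.inr j)) (s q).out (fun _ => false) id (subStart s)
    (update (layout s [] [] (update r i [])) (.inr ⟨q, (s q).tm.k₁⟩) v')
    (by simp) (fun _ _ => rfl)
  have e₁ : update (layout s ([] : List X) ([] : List Y) (update r i []))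
      (.inr ⟨q, (s q).tm.k₀⟩) (u.map (s q).inc) =
      update (layout s [] [] (update r i [])) (.inr ⟨q, (s q).tm.k₀⟩)
        (((layout s ([] : List X) ([] : List Y) r (.inl (.inr i))).map
          fun a => (s q).inc (id a)).reverse ++
          layout s ([] : List X) ([] : List Y) r (.inr ⟨q, (s q).tm.k₀⟩)) := by
    simp [layout, hr]
  rw [← e₁] at h₁
  -- Only the output stack of the subroutine is nonempty at this point; emptying it gives a `layout`
  -- again.
  have e₃ : ∀ z, update (update (update (layout s ([] : List X) ([] : List Y) (update r i []))
      (.inr ⟨q, (s q).tm.k₁⟩) v') (.inl (.inr j)) z) (.inr ⟨q, (s q).tm.k₁⟩) [] =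
      layout s [] [] (update (update r i []) j z) := by
    intro z
    rw [update_comm (by simp), update_idem, update_comm (by simp), update_layout_reg]
    exact update_eq_self (Sum.inr ⟨q, (s q).tm.k₁⟩)
      (layout s ([] : List X) ([] : List Y) (update (update r i []) j z))
  rw [e₃] at h₃
  refine Does.of_eq (Prog.Runs.mono (A := Option Bool) (Prog.Runs.seq h₁ (Prog.Runs.seq h₂ h₃)) ?_) ?_
  · simp [layout, hr]
  · simp [layout]

end RegProg

-- The machine copies its input to the register `i`, runs `F` and copies the register `o` to its
-- output stack. Copying reverses a word, hence the reversed codes. The time for copying out is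
-- under control because the output length is bounded by the time of `F`.
open RegProg in
theorem polyTime_of_does {α β : Type} [Code X] [Code Y] {ea : α → List X} {eb : β → List Y}
    {f : α → β} [Fintype Q] (F : RegProg s N X Y) (i o : Fin N) (t : α → ℕ)
    (ht : PolyBounded (fun a => (ea a).length) t)
    (hF : ∀ a, F.Does (update (fun _ => []) i (code (ea a)).reverse)
      (update (fun _ => []) o (code (eb (f a))).reverse) (t a)) :
    OneWay.PolyTime ea eb f := by
  obtain ⟨C, hC⟩ := F.exists_length_le
  have hlen : ∀ a, (eb (f a)).length ≤ (ea a).length + C * t a := by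
    intro a
    have h := hC _ _ _ _ ⟨none⟩ (hF a) (.inl (.inr o))
    simp only [layout, update_self] at h
    have h' : (update (fun _ => []) i (code (ea a)).reverse o).length ≤ (ea a).length := by
      by_cases hio : o = i
      · subst hio; simp [code]
      · simp [hio]
    simp only [code, List.length_reverse, List.length_map] at h h'
    lia
  let inp : RegProg s N X Y := Prog.move (Γ := stkAlph s N X Y) (.inl (.inl false)) (.inl (.inr i))
    Code.enc (fun _ => false) id
  let out : RegProg s N X Y := Prog.move (Γ := stkAlph s N X Y) (.inl (.inr o)) (.inl (.inl true))
    id (fun _ => false) Code.dec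
  -- The final `load` is needed because `haltList` demands the initial state, whereas a run leaves
  -- an arbitrary second component.
  let all : RegProg s N X Y := (inp.seq (F.seq out)).seq (Prog.load fun v => (v.1, none))
  have := fun q => (s q).tm.kFin
  have := fun q => (s q).tm.σFin
  let tm : FinTM2 :=
    { K := Stk s N
      k₀ := .inl (.inl false)
      k₁ := .inl (.inl true)
      Γ := stkAlph s N X Y
      Λ := all.Λ
      main := all.main
      σ := (SubState fun q => (s q).tm) × Option (Option Bool)
      initialState := (subStart s, none)
      Γk₀Fin := (inferInstance : Fintype X)
      m := all.m }
  obtain ⟨p, hp⟩ : PolyBounded (fun a => (ea a).length) fun a =>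
      2 * (ea a).length + 1 + (t a + (2 * ((ea a).length + C * t a) + 1)) + 1 :=
    .add (.add (.add (.mul (.const 2) .self) (.const 1)) (.add ht (.add (.mul (.const 2)
      (.add .self (.mul (.const C) ht))) (.const 1)))) (.const 1)
  have hrun : ∀ a, ∃ n ≤ 2 * (ea a).length + 1 + (t a + (2 * ((ea a).length + C * t a) + 1)) + 1,
      all.Eval n (subStart s, none) (subStart s, none) (layout s (ea a) [] fun _ => [])
        (layout s [] (eb (f a)) fun _ => []) := by
    intro a
    have h₁ := Prog.runs_move (Γ := stkAlph s N X Y) (k := .inl (.inl false)) (k' := .inl (.inr i))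
      Code.enc (fun _ => false) id (subStart s) (layout s (ea a) [] fun _ => []) (by simp)
      (fun _ _ => rfl)
    rw [update_layout_reg, update_layout_inp] at h₁
    have h₂ := Prog.runs_move (Γ := stkAlph s N X Y) (k := .inl (.inr o)) (k' := .inl (.inl true))
      id (fun _ => false) Code.dec (subStart s)
      (layout s [] [] (update (fun _ => []) o (code (eb (f a))).reverse)) (by simp)
      (fun _ _ => rfl)
    rw [update_layout_out, update_layout_reg] at h₂
    have e₁ : update (fun _ : Fin N => []) i (((layout s (ea a) ([] : List Y) (fun _ : Fin N => [])
        (.inl (.inl false))).map fun a => id (Code.enc a)).reverse ++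
        layout s (ea a) ([] : List Y) (fun _ : Fin N => []) (.inl (.inr i))) =
        update (fun _ : Fin N => []) i (code (ea a)).reverse := by
      simp [layout, code]
    rw [e₁] at h₁
    have e₂ : ((layout s ([] : List X) ([] : List Y) (update (fun _ => []) o
        (code (eb (f a))).reverse) (.inl (.inr o))).map fun a => Code.dec (id a)).reverse ++
        layout s ([] : List X) ([] : List Y) (update (fun _ => []) o
        (code (eb (f a))).reverse) (.inl (.inl true)) = eb (f a) := by
      simp [layout, code, Function.comp_def, Code.dec_enc]
    rw [e₂, update_idem, update_eq_self o (fun _ => ([] : List (Option Bool)))] at h₂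
    obtain ⟨v', n, hn, h⟩ := Prog.Runs.seq h₁ (Prog.Runs.seq (hF a) h₂) none
    refine ⟨n + 1, ?_, h.seq (Prog.eval_load _ _ _)⟩
    have := hlen a
    simp only [layout, update_self, code, List.length_reverse, List.length_map] at hn
    lia
  exact ⟨
    { tm := tm
      inputAlphabet := Equiv.refl X
      outputAlphabet := Equiv.refl Y
      time := p
      outputsFun := fun a => by
        have e₁ : initList tm (ea a) =
            ⟨some all.main, (subStart s, none), layout s (ea a) [] fun _ => []⟩ := by
          refine congrArg (TM2.Cfg.mk (some all.main) (subStart s, none)) (funext fun k => ?_)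
          by_cases hk : k = .inl (.inl false)
          · subst hk; exact initList_self tm (ea a)
          · refine (initList_of_ne (tm := tm) (ea a) hk).trans ?_
            rcases k with ((_ | _) | k) | k <;> first | rfl | exact absurd rfl hk
        have e₂ : haltList tm (eb (f a)) =
            ⟨none, (subStart s, none), layout s [] (eb (f a)) fun _ => []⟩ := by
          refine congrArg (TM2.Cfg.mk none (subStart s, none)) (funext fun k => ?_)
          by_cases hk : k = .inl (.inl true)
          · subst hk; exact haltList_self tm (eb (f a))
          · refine (haltList_of_ne (tm := tm) (eb (f a)) hk).trans ?_
            rcases k with ((_ | _) | k) | k <;> first | rfl | exact absurd rfl hk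
        have h := hrun a
        refine ⟨⟨h.choose, ?_⟩, h.choose_spec.1.trans (hp a)⟩
        have h' := steps_iff_iterate.1 h.choose_spec.2
        change (flip bind (TM2.step all.m))^[h.choose] (some (initList tm (List.map id (ea a)))) =
          some (haltList tm (List.map id (eb (f a))))
        rw [List.map_id, List.map_id, e₁, e₂]
        exact h' }⟩

end Registers

open OneWay

/-! ### Updates of six registers -/

section Registers

variable {α : Type} (a b c d e f x : α)

@[simp]
theorem update_vec₀ : update ![a, b, c, d, e, f] 0 x = ![x, b, c, d, e, f] := by
  funext i; fin_cases i <;> rfl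

@[simp]
theorem update_vec₁ : update ![a, b, c, d, e, f] 1 x = ![a, x, c, d, e, f] := by
  funext i; fin_cases i <;> rfl

@[simp]
theorem update_vec₂ : update ![a, b, c, d, e, f] 2 x = ![a, b, x, d, e, f] := by
  funext i; fin_cases i <;> rfl

@[simp]
theorem update_vec₃ : update ![a, b, c, d, e, f] 3 x = ![a, b, c, x, e, f] := by
  funext i; fin_cases i <;> rfl

@[simp]
theorem update_vec₄ : update ![a, b, c, d, e, f] 4 x = ![a, b, c, d, x, f] := by
  funext i; fin_cases i <;> rfl

@[simp]
theorem update_vec₅ : update ![a, b, c, d, e, f] 5 x = ![a, b, c, d, e, x] := by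
  funext i; fin_cases i <;> rfl

end Registers

/-- All registers empty. -/
theorem const_nil_eq : (fun _ : Fin 6 => ([] : List (Option Bool))) = ![[], [], [], [], [], []] := by
  funext i; fin_cases i <;> rfl

section Clear

variable {Q : Type} [DecidableEq Q] {N : ℕ} {X Y : Type} {s : Q → Sub}

namespace RegProg

/-- Empty the register `i`. -/
def clear (i : Fin N) : RegProg s N X Y := loop i fun _ => Prog.skip

theorem does_clear {i : Fin N} {r : Fin N → List (Option Bool)} :
    (clear i : RegProg s N X Y).Does r (update r i []) (2 * (r i).length + 1) := by
  generalize hl : r i = l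
  induction l generalizing r with
  | nil =>
    refine (does_loop_nil hl).of_eq ?_
    rw [← hl, update_eq_self]
  | cons a l ih =>
    refine ((Does.loop_cons hl does_skip (ih (r := update r i l) (by simp))).of_eq ?_).mono
      (t := 1 + 1 + (2 * l.length + 1)) (by rw [List.length_cons]; lia)
    simp

end RegProg

end Clear

/-! ### Closure under composition and pairing -/

section Closure

open RegProg PolyBounded

variable {α β γ X Y Z : Type} [Code X] [Code Y] [Code Z] {ea : α → List X} {eb : β → List Y}
  {ec : γ → List Z}

@[simp]
theorem length_code (u : List X) : (code u).length = u.length := by simp [code]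

/-- The second time bound is evaluated at the length of the intermediate word, which is polynomial
by `polyBounded_length`. -/
theorem polyTime_comp {f : α → β} {g : β → γ} (hf : PolyTime ea eb f) (hg : PolyTime eb ec g) :
    PolyTime ea ec fun a => g (f a) := by
  have hl := polyBounded_length hf
  have hl' := polyBounded_length hg
  obtain ⟨sf, p, hp⟩ := exists_sub hf
  obtain ⟨sg, q, hq⟩ := exists_sub hg
  have hl'' : PolyBounded (fun a => (ea a).length) fun a => (ec (g (f a))).length := by
    obtain ⟨r, hr⟩ := hl'
    exact (PolyBounded.eval r hl).mono fun a => hr (f a)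
  refine polyTime_of_does (s := fun b : Bool => cond b sg sf)
    ((call false 0 1).seq (call true 1 2) : RegProg _ 6 X Z) 0 2
    (fun a => 2 * (ea a).length + 1 + (p.eval (ea a).length + (2 * (eb (f a)).length + 1)) +
      (2 * (eb (f a)).length + 1 + (q.eval (eb (f a)).length + (2 * (ec (g (f a))).length + 1))))
    ?_ fun a => ?_
  · exact .add (.add (.add (.mul (.const 2) .self) (.const 1)) (.add (.eval p .self)
      (.add (.mul (.const 2) hl) (.const 1)))) (.add (.add (.mul (.const 2) hl) (.const 1))
      (.add (.eval q hl) (.add (.mul (.const 2) hl'') (.const 1))))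
  · rw [const_nil_eq, update_vec₀, update_vec₂]
    have h₁ := does_call (s := fun b : Bool => cond b sg sf) (X := X) (Y := Z) (q := false)
      (i := (0 : Fin 6)) (j := 1) (r := ![(code (ea a)).reverse, [], [], [], [], []]) (hp a) rfl
    have h₂ := does_call (s := fun b : Bool => cond b sg sf) (X := X) (Y := Z) (q := true)
      (i := (1 : Fin 6)) (j := 2) (r := ![[], (code (eb (f a))).reverse, [], [], [], []])
      (hq (f a)) rfl
    simp only [length_code, update_vec₀, update_vec₁, update_vec₂] at h₁ h₂
    simp at h₁ h₂
    exact h₁.seq h₂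

/-- Prepend a symbol. -/
theorem polyTime_cons {f : α → β} (c : Option Bool)
    (hf : ∀ a, code (eb (f a)) = c :: code (ea a)) : PolyTime ea eb f := by
  refine polyTime_of_does (s := fun e : Empty => e.elim)
    ((move 0 1).seq ((push 1 c).seq (move 1 2)) : RegProg _ 6 X Y) 0 2
    (fun a => 2 * (ea a).length + 1 + (1 + (2 * ((ea a).length + 1) + 1)))
    (.add (.add (.mul (.const 2) .self) (.const 1)) (.add (.const 1)
      (.add (.mul (.const 2) (.add .self (.const 1))) (.const 1)))) fun a => ?_
  rw [const_nil_eq, update_vec₀, update_vec₂, hf]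
  exact ((does_move (by decide)).of_eq (r'' := ![[], code (ea a), [], [], [], []]) (by simp)).mono
      (by simp) |>.seq
    ((((does_push 1 c).of_eq (r'' := ![[], c :: code (ea a), [], [], [], []]) (by simp))).seq
    (((does_move (by decide)).of_eq (by simp)).mono (by simp)))

theorem code_encPair (p : Str × Str) : code (encPair p) = p.1.map some ++ none :: p.2.map some := by
  simp [code, encPair, Code.enc]

theorem code_str (u : Str) : code u = u.map some := rfl

/-- The time of the programs for `polyTime_pair_left` and `polyTime_pair_right`. -/
theorem polyBounded_pair {f : Str → Str} (hf : FP f) (p : Polynomial ℕ) :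
    PolyBounded (fun z : Str => (id z).length) fun z =>
      2 * z.length + 1 + (3 * z.length + 1 + (2 * z.length + 1 + (p.eval z.length +
        (2 * (f z).length + 1)) + (1 + (2 * (f z).length + 1 + (2 * (f z).length + 1) +
          (2 * z.length + 1 + (2 * z.length + 1)))))) := by
  have hl := polyBounded_length hf
  have hz : PolyBounded (fun z : Str => (id z).length) fun z => 2 * z.length + 1 :=
    .add (.mul (.const 2) .self) (.const 1)
  have hfz : PolyBounded (fun z : Str => (id z).length) fun z => 2 * (f z).length + 1 :=
    .add (.mul (.const 2) hl) (.const 1)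
  exact .add hz (.add (.add (.mul (.const 3) .self) (.const 1)) (.add (.add hz (.add (.eval p .self)
    hfz)) (.add (.const 1) (.add (.add hfz hfz) (.add hz hz)))))

/-- Together with `polyTime_pair_right`, this turns an inverter that finds one missing argument into
one that outputs both. The word is duplicated because the call consumes a copy; the last two moves
reverse the result twice and thus keep its orientation. -/
theorem polyTime_pair_left {f : Str → Str} (hf : FP f) : FPToPair fun z => (z, f z) := by
  obtain ⟨s, p, hp⟩ := exists_sub hf
  refine polyTime_of_does (s := fun _ : Unit => s)
    ((move 0 1).seq ((dup 1 2 3).seq ((call () 2 4).seq ((push 3 none).seq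
      ((move 4 1).seq (move 1 3))))) : RegProg _ 6 Bool (Option Bool)) 0 3 _
    (polyBounded_pair hf p) fun z => ?_
  rw [const_nil_eq, update_vec₀, update_vec₃, code_encPair, id, code_str]
  have h₁ := does_move (s := fun _ : Unit => s) (X := Bool) (Y := Option Bool) (i := (0 : Fin 6))
    (j := 1) (r := ![(z.map some).reverse, [], [], [], [], []]) (by decide)
  have h₂ := does_dup (s := fun _ : Unit => s) (X := Bool) (Y := Option Bool) (i := (1 : Fin 6))
    (j := 2) (k := 3) (r := ![[], z.map some, [], [], [], []]) (by decide) (by decide) (by decide)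
  have h₃ := does_call (s := fun _ : Unit => s) (X := Bool) (Y := Option Bool) (q := ())
    (i := (2 : Fin 6)) (j := 4)
    (r := ![[], [], (z.map some).reverse, (z.map some).reverse, [], []]) (hp z) rfl
  have h₄ := does_push (s := fun _ : Unit => s) (X := Bool) (Y := Option Bool) (3 : Fin 6) none
    (r := ![[], [], [], (z.map some).reverse, ((f z).map some).reverse, []])
  have h₅ := does_move (s := fun _ : Unit => s) (X := Bool) (Y := Option Bool) (i := (4 : Fin 6))
    (j := 1) (r := ![[], [], [], none :: (z.map some).reverse, ((f z).map some).reverse, []])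
    (by decide)
  have h₆ := does_move (s := fun _ : Unit => s) (X := Bool) (Y := Option Bool) (i := (1 : Fin 6))
    (j := 3) (r := ![[], (f z).map some, [], none :: (z.map some).reverse, [], []])
    (by decide)
  simp [code_str] at h₁ h₂ h₃ h₄ h₅ h₆
  have h := (h₁.seq (h₂.seq (h₃.seq (h₄.seq (h₅.seq h₆)))))
  simp
  exact h.mono (by lia)

theorem polyTime_pair_right {f : Str → Str} (hf : FP f) : FPToPair fun z => (f z, z) := by
  obtain ⟨s, p, hp⟩ := exists_sub hf
  refine polyTime_of_does (s := fun _ : Unit => s)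
    ((move 0 1).seq ((dup 1 2 3).seq ((call () 2 4).seq ((push 4 none).seq
      ((move 3 1).seq (move 1 4))))) : RegProg _ 6 Bool (Option Bool)) 0 4 _
    (polyBounded_pair hf p) fun z => ?_
  rw [const_nil_eq, update_vec₀, update_vec₄, code_encPair, id, code_str]
  have h₁ := does_move (s := fun _ : Unit => s) (X := Bool) (Y := Option Bool) (i := (0 : Fin 6))
    (j := 1) (r := ![(z.map some).reverse, [], [], [], [], []]) (by decide)
  have h₂ := does_dup (s := fun _ : Unit => s) (X := Bool) (Y := Option Bool) (i := (1 : Fin 6))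
    (j := 2) (k := 3) (r := ![[], z.map some, [], [], [], []]) (by decide) (by decide) (by decide)
  have h₃ := does_call (s := fun _ : Unit => s) (X := Bool) (Y := Option Bool) (q := ())
    (i := (2 : Fin 6)) (j := 4)
    (r := ![[], [], (z.map some).reverse, (z.map some).reverse, [], []]) (hp z) rfl
  have h₄ := does_push (s := fun _ : Unit => s) (X := Bool) (Y := Option Bool) (4 : Fin 6) none
    (r := ![[], [], [], (z.map some).reverse, ((f z).map some).reverse, []])
  have h₅ := does_move (s := fun _ : Unit => s) (X := Bool) (Y := Option Bool) (i := (3 : Fin 6))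
    (j := 1) (r := ![[], [], [], (z.map some).reverse, none :: ((f z).map some).reverse, []])
    (by decide)
  have h₆ := does_move (s := fun _ : Unit => s) (X := Bool) (Y := Option Bool) (i := (1 : Fin 6))
    (j := 4) (r := ![[], z.map some, [], [], none :: ((f z).map some).reverse, []])
    (by decide)
  simp [code_str] at h₁ h₂ h₃ h₄ h₅ h₆
  have h := (h₁.seq (h₂.seq (h₃.seq (h₄.seq (h₅.seq h₆)))))
  simp
  exact h.mono (by lia)

end Closure

/-! ### Equality test and evaluation of the hard function -/

open RegProg PolyBounded

/-- The marks left by a comparison of `l` with the beginning of `m`, on top of `k`. -/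
def mismatches {A : Type} [DecidableEq A] : List A → List A → List (Option Bool) → List (Option Bool)
  | [], _, k => k
  | a :: l, m, k => mismatches l m.tail (if m.head? = some a then k else none :: k)

theorem length_mismatches_le {A : Type} [DecidableEq A] (l m : List A) (k : List (Option Bool)) :
    (mismatches l m k).length ≤ l.length + k.length := by
  induction l generalizing m k with
  | nil => simp [mismatches]
  | cons a l ih =>
    refine (ih _ _).trans ?_
    split_ifs
    · simp
    · simp; lia

/-- If `l` is the longer word, its surplus symbols meet `none` and leave marks; if `m` is the longer
one, a remainder of `m` survives. The induction needs an arbitrary `k`. -/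
theorem mismatches_eq_nil {A : Type} [DecidableEq A] (l m : List A) (k : List (Option Bool)) :
    mismatches l m k = [] ∧ m.drop l.length = [] ↔ k = [] ∧ l = m := by
  induction l generalizing m k with
  | nil => simp [mismatches, eq_comm]
  | cons a l ih =>
    cases m with
    | nil => simpa [mismatches] using ih [] (none :: k)
    | cons b m =>
      by_cases h : b = a
      · subst h; simpa [mismatches] using ih m k
      · simpa [mismatches, h, Ne.symm h] using ih m (none :: k)

section Compare

variable {Q : Type} [DecidableEq Q] {X Y : Type} {s : Q → Sub}

/-- Compare the register 1 with the register 2 and leave marks in the register 3. -/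
def compare : RegProg s 6 X Y :=
  loop 1 fun a => popCase 2 fun o => if o = some a then Prog.skip else push 3 none

theorem does_compare (l m k : List (Option Bool)) :
    (compare : RegProg s 6 X Y).Does ![[], l, m, k, [], []]
      ![[], [], m.drop l.length, mismatches l m k, [], []] (3 * l.length + 1) := by
  induction l generalizing m k with
  | nil => exact does_loop_nil rfl
  | cons a l ih =>
    refine (Does.loop_cons (r' := ![[], l, m.tail, if m.head? = some a then k else none :: k, [], []])
      (t := 2) (l := l) (a := a) rfl (.popCase (t := 1) ?_) (ih _ _)).of_eq ?_ |>.mono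
      (by rw [List.length_cons]; lia)
    · simp only [update_vec₁]
      change Does (if m.head? = some a then _ else _) (update _ _ m.tail) _ _
      split_ifs
      · simpa using does_skip
      · exact (does_push _ _).of_eq (by simp)
    · simp [mismatches]

end Compare

theorem polyTime_eq : PolyTime encPair (fun b : Bool => [b]) fun p : Str × Str => p.1 == p.2 := by
  refine polyTime_of_does (s := fun e : Empty => e.elim)
    ((moveSep 0 1).seq ((move 0 2).seq (compare.seq ((popCase 2 fun o =>
      if o.isSome then push 3 none else Prog.skip).seq ((clear 2).seq ((popCase 3 fun o =>
      push 4 (some o.isNone)).seq (clear 3)))))) : RegProg _ 6 (Option Bool) Bool) 0 4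
    -- The phases add up to 4|x| + 7|y| + 11 steps, so the constants are generous.
    (fun p => 12 * (encPair p).length + 20) (.add (.mul (.const 12) .self) (.const 20))
    fun ⟨x, y⟩ => ?_
  rw [const_nil_eq, update_vec₀, update_vec₄, code_encPair]
  have hlen : (encPair (x, y)).length = x.length + y.length + 1 := by
    simp [encPair]; lia
  set u := x.map some with hu
  set v := y.map some with hv
  have hu' : u.length = x.length := by simp [hu]
  have hv' : v.length = y.length := by simp [hv]
  have huv : u = v ↔ x = y := List.map_inj_right (fun a b h => Option.some.inj h)
  have hml := length_mismatches_le v u []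
  set k := mismatches v u [] with hk
  have h₁ : Does (moveSep 0 1 : RegProg (fun e : Empty => e.elim) 6 (Option Bool) Bool)
      ![(u ++ none :: v).reverse, [], [], [], [], []] ![u.reverse, v, [], [], [], []]
      (2 * y.length + 1) :=
    ((does_moveSep (by decide) y.reverse u.reverse (by simp [hv])).of_eq (by simp [hv])).mono
      (by simp)
  have h₂ : Does (move 0 2 : RegProg (fun e : Empty => e.elim) 6 (Option Bool) Bool)
      ![u.reverse, v, [], [], [], []] ![[], v, u, [], [], []] (2 * x.length + 1) :=
    ((does_move (by decide)).of_eq (by simp)).mono (by simp [hu'])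
  have h₃ := does_compare (X := Option Bool) (Y := Bool) (s := fun e : Empty => e.elim) v u []
  -- A remainder of `u` counts as one more mark, so that the words are equal exactly if `k'` is
  -- empty.
  set k' := if (u.drop v.length).head?.isSome then none :: k else k with hk'
  have h₄ : Does (popCase 2 fun o => if o.isSome then push 3 none else Prog.skip :
      RegProg (fun e : Empty => e.elim) 6 (Option Bool) Bool)
      ![[], [], u.drop v.length, k, [], []] ![[], [], (u.drop v.length).tail, k', [], []]
      (1 + 1) := by
    refine .popCase ?_
    rw [update_vec₂]
    change Does (if (u.drop v.length).head?.isSome then _ else _) ![_, _, (u.drop v.length).tail, _, _, _]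
      _ _
    rw [hk']
    split_ifs
    · exact (does_push _ _).of_eq (by simp)
    · exact does_skip
  have h₅ : Does (clear 2 : RegProg (fun e : Empty => e.elim) 6 (Option Bool) Bool)
      ![[], [], (u.drop v.length).tail, k', [], []] ![[], [], [], k', [], []]
      (2 * x.length + 1) :=
    (does_clear.of_eq (by simp)).mono (by simp [hu'])
  have h₆ : Does (popCase 3 fun o => push 4 (some o.isNone) :
      RegProg (fun e : Empty => e.elim) 6 (Option Bool) Bool)
      ![[], [], [], k', [], []] ![[], [], [], k'.tail, [some (x == y)], []] (1 + 1) := by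
    refine .popCase ((does_push _ _).of_eq ?_)
    have : k'.head?.isNone = (x == y) := by
      rw [Bool.eq_iff_iff, beq_iff_eq, ← huv, eq_comm (a := u)]
      have h : k = [] ∧ u.drop v.length = [] ↔ v = u := by
        simpa only [true_and] using mismatches_eq_nil v u []
      rw [← h, hk']
      generalize u.drop v.length = d
      generalize k = k
      cases d <;> cases k <;> simp
    simp [this]
  have h₇ : Does (clear 3 : RegProg (fun e : Empty => e.elim) 6 (Option Bool) Bool)
      ![[], [], [], k'.tail, [some (x == y)], []] ![[], [], [], [], [some (x == y)], []]
      (2 * (y.length + 1) + 1) := by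
    refine (does_clear.of_eq (by simp)).mono ?_
    have : k'.length ≤ k.length + 1 := by rw [hk']; split_ifs <;> simp
    simp only [List.length_nil] at hml
    simp
    lia
  refine ((h₁.seq (h₂.seq (h₃.seq (h₄.seq (h₅.seq (h₆.seq h₇)))))).of_eq ?_).mono ?_
  · simp [code, Code.enc]
  · lia

/-- This is the verifier for a language in P, with the empty word as the only witness. The register
shows the end of the input first: `y` is empty exactly if the separator is on top, and popping it
leaves the reversed `x` that the call expects. -/
theorem polyTime_and_isEmpty {χ : Str → Bool} (hχ : PolyTime id (fun b : Bool => [b]) χ) :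
    PolyTime encPair (fun b : Bool => [b]) fun p : Str × Str => χ p.1 && p.2.isEmpty := by
  obtain ⟨s, p, hp⟩ := exists_sub hχ
  refine polyTime_of_does (s := fun _ : Unit => s)
    (popCase 0 fun o => if o = some none then call () 0 1 else (clear 0).seq (push 1 (some false)) :
      RegProg _ 6 (Option Bool) Bool) 0 1
    (fun z => 1 + (2 * (encPair z).length + 10 + p.eval (encPair z).length))
    (.add (.const 1) (.add (.add (.mul (.const 2) .self) (.const 10)) (.eval p .self)))
    fun ⟨x, y⟩ => ?_
  rw [const_nil_eq, update_vec₀, update_vec₁, code_encPair]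
  have hlen : (encPair (x, y)).length = x.length + y.length + 1 := by
    simp [encPair]; lia
  refine .popCase ?_
  rw [update_vec₀]
  rcases List.eq_nil_or_concat y with rfl | ⟨y, b, rfl⟩
  · have h := does_call (s := fun _ : Unit => s) (X := Option Bool) (Y := Bool) (q := ())
      (i := (0 : Fin 6)) (j := 1) (r := ![(x.map some).reverse, [], [], [], [], []]) (hp x) rfl
    simp [code, Code.enc] at h ⊢
    refine h.mono ?_
    have := eval_mono p (show x.length ≤ (encPair (x, [])).length by lia)
    lia
  · simp [code, Code.enc]
    refine ((does_clear.seq (does_push _ _)).of_eq (by simp)).mono ?_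
    simp at hlen ⊢
    lia

/-- The value of the first component, provided that the second one is a witness for it. -/
def witnessed (R : Str → Str → Bool) : Str → Str → Str
  | false :: x, true :: w => if R x w then false :: x else []
  | true :: w, false :: x => if R x w then false :: x else []
  | _, _ => []

theorem polyTimeComputable_witnessed {R : Str → Str → Bool}
    (hR : PolyTime encPair (fun b : Bool => [b]) fun p : Str × Str => R p.1 p.2) :
    PolyTimeComputable (witnessed R) := by
  obtain ⟨s, p, hp⟩ := exists_sub hR
  -- The register `i` holds x and `j` holds w. The output 0x is prepared in register 4, reversed,
  -- while the question x#w is assembled in register 3; a negative verdict in register 5 erases the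
  -- output.
  let check (i j : Fin 6) : RegProg (fun _ : Unit => s) 6 (Option Bool) Bool :=
    (push 4 (some false)).seq ((dup i 3 4).seq ((push 3 none).seq ((move j 3).seq ((call () 3 5).seq
      (popCase 5 fun o => if o = some (some true) then Prog.skip else clear 4)))))
  have hcheck : ∀ x w : Str,
      (check 2 1).Does ![[], w.map some, x.map some, [], [], []]
        ![[], [], [], [], if R x w then ((false :: x).map some).reverse else [], []]
        (20 * (x.length + w.length) + 20 + p.eval (x.length + w.length + 1)) ∧
      (check 1 2).Does ![[], x.map some, w.map some, [], [], []]
        ![[], [], [], [], if R x w then ((false :: x).map some).reverse else [], []]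
        (20 * (x.length + w.length) + 20 + p.eval (x.length + w.length + 1)) := by
    intro x w
    have hlen : (encPair (x, w)).length = x.length + w.length + 1 := by
      simp [encPair]; lia
    have h₄ : Does (move 1 3 : RegProg (fun _ : Unit => s) 6 (Option Bool) Bool)
        ![[], w.map some, [], none :: (x.map some).reverse, ((false :: x).map some).reverse, []]
        ![[], [], [], (code (encPair (x, w))).reverse, ((false :: x).map some).reverse, []]
        (2 * w.length + 1) :=
      ((does_move (by decide)).of_eq (by simp [code_encPair])).mono (by simp)
    have h₄' : Does (move 2 3 : RegProg (fun _ : Unit => s) 6 (Option Bool) Bool)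
        ![[], [], w.map some, none :: (x.map some).reverse, ((false :: x).map some).reverse, []]
        ![[], [], [], (code (encPair (x, w))).reverse, ((false :: x).map some).reverse, []]
        (2 * w.length + 1) :=
      ((does_move (by decide)).of_eq (by simp [code_encPair])).mono (by simp)
    have h₅ : Does (call () 3 5 : RegProg (fun _ : Unit => s) 6 (Option Bool) Bool)
        ![[], [], [], (code (encPair (x, w))).reverse, ((false :: x).map some).reverse, []]
        ![[], [], [], [], ((false :: x).map some).reverse, [some (R x w)]]
        (2 * (x.length + w.length + 1) + 1 + (p.eval (x.length + w.length + 1) + 3)) :=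
      ((does_call (hp (x, w)) rfl).of_eq (by simp [code, Code.enc])).mono (by simp [hlen])
    have h₆ : Does (popCase 5 fun o => if o = some (some true) then Prog.skip else clear 4 :
        RegProg (fun _ : Unit => s) 6 (Option Bool) Bool)
        ![[], [], [], [], ((false :: x).map some).reverse, [some (R x w)]]
        ![[], [], [], [], if R x w then ((false :: x).map some).reverse else [], []]
        (1 + (2 * (x.length + 1) + 1)) := by
      refine .popCase ?_
      rw [update_vec₅]
      cases h : R x w
      · simp
        exact (does_clear.of_eq (by simp)).mono (by simp)
      · simp
        exact does_skip.mono (by lia)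
    constructor
    · have h₁ : Does (push 4 (some false) : RegProg (fun _ : Unit => s) 6 (Option Bool) Bool)
          ![[], w.map some, x.map some, [], [], []]
          ![[], w.map some, x.map some, [], [some false], []] 1 :=
        (does_push _ _).of_eq (by simp)
      have h₂ : Does (dup 2 3 4 : RegProg (fun _ : Unit => s) 6 (Option Bool) Bool)
          ![[], w.map some, x.map some, [], [some false], []]
          ![[], w.map some, [], (x.map some).reverse, ((false :: x).map some).reverse, []]
          (3 * x.length + 1) :=
        ((does_dup (by decide) (by decide) (by decide)).of_eq (by simp)).mono (by simp)
      have h₃ : Does (push 3 none : RegProg (fun _ : Unit => s) 6 (Option Bool) Bool)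
          ![[], w.map some, [], (x.map some).reverse, ((false :: x).map some).reverse, []]
          ![[], w.map some, [], none :: (x.map some).reverse, ((false :: x).map some).reverse, []] 1 :=
        (does_push _ _).of_eq (by simp)
      exact (h₁.seq (h₂.seq (h₃.seq (h₄.seq (h₅.seq h₆))))).mono (by lia)
    · have h₁ : Does (push 4 (some false) : RegProg (fun _ : Unit => s) 6 (Option Bool) Bool)
          ![[], x.map some, w.map some, [], [], []]
          ![[], x.map some, w.map some, [], [some false], []] 1 :=
        (does_push _ _).of_eq (by simp)
      have h₂ : Does (dup 1 3 4 : RegProg (fun _ : Unit => s) 6 (Option Bool) Bool)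
          ![[], x.map some, w.map some, [], [some false], []]
          ![[], [], w.map some, (x.map some).reverse, ((false :: x).map some).reverse, []]
          (3 * x.length + 1) :=
        ((does_dup (by decide) (by decide) (by decide)).of_eq (by simp)).mono (by simp)
      have h₃ : Does (push 3 none : RegProg (fun _ : Unit => s) 6 (Option Bool) Bool)
          ![[], [], w.map some, (x.map some).reverse, ((false :: x).map some).reverse, []]
          ![[], [], w.map some, none :: (x.map some).reverse, ((false :: x).map some).reverse, []] 1 :=
        (does_push _ _).of_eq (by simp)
      exact (h₁.seq (h₂.seq (h₃.seq (h₄'.seq (h₅.seq h₆))))).mono (by lia)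
  -- `t` and `t'` are the leading symbols of the first and the second argument, which are held in
  -- the registers 2 and 1.
  let dispatch (t t' : Option (Option Bool)) : RegProg (fun _ : Unit => s) 6 (Option Bool) Bool :=
    if t = some (some false) ∧ t' = some (some true) then check 2 1
    else if t = some (some true) ∧ t' = some (some false) then check 1 2
    else (clear 1).seq (clear 2)
  refine polyTime_of_does (s := fun _ : Unit => s)
    ((moveSep 0 1).seq ((move 0 2).seq (popCase 1 fun t' => popCase 2 fun t => dispatch t t')) :
      RegProg _ 6 (Option Bool) Bool) 0 4
    (fun z => 30 * (encPair z).length + 30 + p.eval (encPair z).length)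
    (.add (.add (.mul (.const 30) .self) (.const 30)) (.eval p .self))
    fun ⟨a, b⟩ => ?_
  rw [const_nil_eq, update_vec₀, update_vec₄, code_encPair, id, code_str]
  have hlen : (encPair (a, b)).length = a.length + b.length + 1 := by
    simp [encPair]; lia
  have h₁ : Does (moveSep 0 1 : RegProg (fun _ : Unit => s) 6 (Option Bool) Bool)
      ![(a.map some ++ none :: b.map some).reverse, [], [], [], [], []]
      ![(a.map some).reverse, b.map some, [], [], [], []]
      (2 * b.length + 1) :=
    ((does_moveSep (by decide) b.reverse (a.map some).reverse (by simp)).of_eq (by simp)).mono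
      (by simp)
  have h₂ : Does (move 0 2 : RegProg (fun _ : Unit => s) 6 (Option Bool) Bool)
      ![(a.map some).reverse, b.map some, [], [], [], []] ![[], b.map some, a.map some, [], [], []]
      (2 * a.length + 1) :=
    ((does_move (by decide)).of_eq (by simp)).mono (by simp)
  have h₃ : Does (dispatch (a.map some).head? (b.map some).head?)
      ![[], (b.map some).tail, (a.map some).tail, [], [], []]
      ![[], [], [], [], ((witnessed R a b).map some).reverse, []]
      (20 * (a.length + b.length) + 20 + p.eval (a.length + b.length + 1)) := by
    have hclear : Does ((clear 1).seq (clear 2) : RegProg (fun _ : Unit => s) 6 (Option Bool) Bool)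
        ![[], (b.map some).tail, (a.map some).tail, [], [], []] ![[], [], [], [], [], []]
        (20 * (a.length + b.length) + 20 + p.eval (a.length + b.length + 1)) :=
      ((does_clear.seq does_clear).of_eq (by simp)).mono (by simp; lia)
    have hbound : ∀ m n, m + 1 ≤ a.length → n + 1 ≤ b.length →
        20 * (m + n) + 20 + p.eval (m + n + 1) ≤
          20 * (a.length + b.length) + 20 + p.eval (a.length + b.length + 1) := fun m n hm hn =>
      add_le_add (by lia) (eval_mono p (by lia))
    match a, b, hbound, hclear with
    | false :: x, true :: w, hbound, _ =>
      refine ((hcheck x w).1.of_eq ?_).mono (hbound _ _ le_rfl le_rfl)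
      cases h : R x w <;> simp [witnessed, h]
    | true :: w, false :: x, hbound, _ =>
      refine ((hcheck x w).2.of_eq ?_).mono ((add_comm w.length x.length) ▸ hbound _ _ le_rfl le_rfl)
      cases h : R x w <;> simp [witnessed, h]
    | [], b, _, h => simpa [dispatch, witnessed] using h
    | false :: x, [], _, h => simpa [dispatch, witnessed] using h
    | true :: x, [], _, h => simpa [dispatch, witnessed] using h
    | false :: x, false :: y, _, h => simpa [dispatch, witnessed] using h
    | true :: x, true :: y, _, h => simpa [dispatch, witnessed] using h
  have h₄ : Does (popCase 1 fun t' => popCase 2 fun t => dispatch t t')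
      ![[], b.map some, a.map some, [], [], []]
      ![[], [], [], [], ((witnessed R a b).map some).reverse, []]
      (1 + (1 + (20 * (a.length + b.length) + 20 + p.eval (a.length + b.length + 1)))) := by
    refine .popCase (.popCase ?_)
    rw [update_vec₁, update_vec₂]
    exact h₃
  refine (h₁.seq (h₂.seq h₄)).mono ?_
  rw [hlen]
  lia

end StackProgram

/-! ### Honesty and hardness of the function built from a verifier -/

namespace OneWay

open StackProgram

theorem classP_subset_classNP : ClassP ⊆ ClassNP := by
  rintro L ⟨χ, hχ, hL⟩
  refine ⟨fun x y => χ x && y.isEmpty, polyTime_and_isEmpty hχ, ⟨0, fun x y h => ?_⟩, fun x => ?_⟩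
  · simp only [Bool.and_eq_true, List.isEmpty_iff] at h
    simp [h.2]
  · simp [hL]

variable {R : Str → Str → Bool}

/-- The default value is the empty word, so a nonempty value can only come from an accepted witness,
which is then part of the preimage. -/
theorem witnessed_eq_cons {a b z : Str} {c : Bool} (h : witnessed R a b = c :: z) :
    c = false ∧ ∃ w, R z w = true ∧ (a = false :: z ∧ b = true :: w ∨ a = true :: w ∧ b = false :: z) := by
  unfold witnessed at h
  split at h
  · split_ifs at h with hR
    cases h
    exact ⟨rfl, _, hR, .inl ⟨rfl, rfl⟩⟩
  · split_ifs at h with hR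
    cases h
    exact ⟨rfl, _, hR, .inr ⟨rfl, rfl⟩⟩
  · cases h

theorem witnessed_nil_left (b : Str) : witnessed R [] b = [] := rfl

theorem witnessed_nil_right (a : Str) : witnessed R a [] = [] := by
  unfold witnessed
  split <;> first | rfl | (rename_i h; cases h)

theorem witnessed_left {x w : Str} (h : R x w = true) :
    witnessed R (false :: x) (true :: w) = false :: x := by
  simp [witnessed, h]

theorem witnessed_right {x w : Str} (h : R x w = true) :
    witnessed R (true :: w) (false :: x) = false :: x := by
  simp [witnessed, h]

/-- Being able to find preimages of all `0x` in the image of `witnessed R` is enough to decide the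
language of `R`. -/
theorem mem_classP_of_invert
    (hR : PolyTime encPair (fun b : Bool => [b]) fun p : Str × Str => R p.1 p.2)
    {L : Set Str} (hL : ∀ x, x ∈ L ↔ ∃ y, R x y = true) {H : Str → Str × Str} (hH : FPToPair H)
    (h : ∀ x w, R x w = true →
      witnessed R (H (false :: x)).1 (H (false :: x)).2 = false :: x) : L ∈ ClassP := by
  have hσ : FP fun z => witnessed R (H z).1 (H z).2 :=
    polyTime_comp hH (polyTimeComputable_witnessed hR)
  have hcons : FP fun x => false :: x := polyTime_cons (some false) fun a => rfl
  -- The decision procedure compares 0x with σ(H(0x)).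
  refine ⟨_, polyTime_comp (polyTime_comp hcons (polyTime_pair_left hσ)) polyTime_eq, fun x => ?_⟩
  rw [hL, beq_iff_eq]
  constructor
  · rintro ⟨w, hw⟩
    exact (h x w hw).symm
  · intro h
    obtain ⟨_, w, hw, _⟩ := witnessed_eq_cons h.symm
    -- No assumption on `H` enters here: a successful comparison exhibits a witness by itself.
    exact ⟨w, hw⟩

theorem honest_witnessed {q : Polynomial ℕ} (hq : ∀ x y, R x y = true → y.length ≤ q.eval x.length) :
    Honest (witnessed R) := by
  -- For a value 0x of length n, the preimage (0x, 1w) has total length n + 1 + |w|, and |w| is at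
  -- most q(n) by monotonicity.
  refine ⟨q + Polynomial.X + 1, ?_⟩
  rintro (_ | ⟨c, z⟩) ⟨a, b, h⟩
  · exact ⟨[], [], by simp, witnessed_nil_left _⟩
  · obtain ⟨rfl, w, hw, -⟩ := witnessed_eq_cons h
    refine ⟨false :: z, true :: w, ?_, witnessed_left hw⟩
    have h₁ := hq z w hw
    have h₂ := eval_mono q (Nat.le_succ z.length)
    simp only [List.length_cons, Polynomial.eval_add, Polynomial.eval_X, Polynomial.eval_one]
    lia

theorem sHonest_witnessed {q : Polynomial ℕ} (hq : ∀ x y, R x y = true → y.length ≤ q.eval x.length) :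
    SHonest (witnessed R) := by
  have hbound : ∀ (z w : Str) (n : ℕ), R z w = true →
      (true :: w).length ≤ (q + Polynomial.X + 1).eval ((false :: z).length + n) ∧
        (false :: z).length ≤ (q + Polynomial.X + 1).eval ((false :: z).length + n) := by
    intro z w n hw
    have h₁ := hq z w hw
    have h₂ := eval_mono q (show z.length ≤ z.length + 1 + n by lia)
    simp only [List.length_cons, Polynomial.eval_add, Polynomial.eval_X, Polynomial.eval_one]
    lia
  refine ⟨q + Polynomial.X + 1, ?_, ?_⟩
  · rintro (_ | ⟨c, z⟩) a ⟨b, h⟩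
    -- The empty word is a partner for every argument when the value is empty. For nonempty values
    -- the given partner is already short, being 0x or 1w.
    · exact ⟨[], by simp, witnessed_nil_right _⟩
    · obtain ⟨rfl, w, hw, ⟨rfl, rfl⟩ | ⟨rfl, rfl⟩⟩ := witnessed_eq_cons h
      · exact ⟨_, (hbound z w _ hw).1, h⟩
      · exact ⟨_, (hbound z w _ hw).2, h⟩
  · rintro (_ | ⟨c, z⟩) b ⟨a, h⟩
    · exact ⟨[], by simp, witnessed_nil_left _⟩
    · obtain ⟨rfl, w, hw, ⟨rfl, rfl⟩ | ⟨rfl, rfl⟩⟩ := witnessed_eq_cons h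
      · exact ⟨_, (hbound z w _ hw).2, h⟩
      · exact ⟨_, (hbound z w _ hw).1, h⟩

theorem fp_id : FP fun z => z := ⟨Turing.idComputableInPolyTime id⟩

theorem fpToPair_diag : FPToPair fun z => (z, z) := polyTime_pair_left fp_id

/-! ### Inverters would decide the language -/

section Hard

variable (hR : PolyTime encPair (fun b : Bool => [b]) fun p : Str × Str => R p.1 p.2)
  {L : Set Str} (hL : ∀ x, x ∈ L ↔ ∃ y, R x y = true) (hLP : L ∉ ClassP)

include hR hL hLP

/-- The argument revealed to `f` is taken to be 0x, equal to the value, so the whole query is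
computed from 0x. Any preimage that `f` returns is good enough for the reduction. -/
theorem overstrong_witnessed : Overstrong (witnessed R) := by
  rintro ⟨f, hf, h⟩
  -- The index 0 is written as the bit `false`, so adding it means prepending one symbol.
  have hidx : PolyTime encPair encIdxPair fun p : Str × Str => ((0 : Fin 2), p.1, p.2) :=
    polyTime_cons (some false) fun a => rfl
  exact hLP <| mem_classP_of_invert hR hL (polyTime_comp (polyTime_comp fpToPair_diag hidx) hf)
    fun x w hw => h 0 (false :: x) (false :: x) ⟨true :: w, .inl ⟨witnessed_left hw, rfl⟩⟩

theorem noninvertible_witnessed : Noninvertible (witnessed R) := by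
  rintro ⟨g, hg, h⟩
  exact hLP <| mem_classP_of_invert hR hL hg fun x w hw => h _ ⟨_, _, witnessed_left hw⟩

/-- Value and known argument are both 0x, so the query is `pair z z` with z = 0x. The known argument
is then put back on its own side, left or right. -/
theorem stronglyNoninvertible_witnessed {pair : Str → Str → Str} (hp : IsPairing pair) :
    StronglyNoninvertible pair (witnessed R) := by
  have hd : FP fun z => pair z z := polyTime_comp fpToPair_diag hp.polyTimeComputable
  constructor
  · rintro ⟨g, hg, h⟩
    exact hLP <| mem_classP_of_invert hR hL (polyTime_pair_left (polyTime_comp hd hg))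
      fun x w hw => h _ _ _ (witnessed_left hw)
  · rintro ⟨g, hg, h⟩
    exact hLP <| mem_classP_of_invert hR hL (polyTime_pair_right (polyTime_comp hd hg))
      fun x w hw => h _ _ _ (witnessed_right hw)

end Hard

end OneWay

open OneWay StackProgram in
theorem proposition3p3 (hPNP : OneWay.ClassP ≠ OneWay.ClassNP) :
    ∃ σ : OneWay.Str → OneWay.Str → OneWay.Str,
      OneWay.PolyTimeComputable σ ∧ OneWay.Honest σ ∧ OneWay.SHonest σ ∧ OneWay.Overstrong σ ∧
      OneWay.IsOneWay σ ∧
      ∀ pair : OneWay.Str → OneWay.Str → OneWay.Str,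
        OneWay.IsPairing pair → OneWay.IsStronglyOneWay pair σ := by
  obtain ⟨L, ⟨R, hR, ⟨q, hq⟩, hL⟩, hLP⟩ :=
    Set.exists_of_ssubset (classP_subset_classNP.ssubset_of_ne hPNP)
  have hσ := polyTimeComputable_witnessed hR
  have hh := honest_witnessed hq
  have hs := sHonest_witnessed hq
  exact ⟨witnessed R, hσ, hh, hs, overstrong_witnessed hR hL hLP,
    ⟨hh, hσ, noninvertible_witnessed hR hL hLP⟩,
    fun pair hp => ⟨hs, hσ, stronglyNoninvertible_witnessed hR hL hLP hp⟩⟩
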